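/- **Conventions.** In a forcing notion the stronger condition is the larger one. $\nu\vartriangleleft\eta$ means that $\nu$ is a proper initial segment of $\eta$. Let $\mathbf H$ be a sequence of sets $\mathbf H(i)$, $i<\omega$, and let $\mathrm{Seq}=\bigcup_{n<\omega}\prod_{i<n}\mathbf H(i)$. *Quasi trees.* A quasi tree is a set $T$ of finite sequences with a $\trianglelefteq$-smallest element $\mathrm{root}(T)$. For $\eta\in T$, $\mathrm{suc}_T(\eta)$ is the set of immediate $\vartriangleleft$-successors of $\eta$ in $T$, $T^{[\eta]}=\{\nu\in T:\eta\trianglelefteq\nu\}$, $\max(T)$ is the set of $\vartriangleleft$-maximal elements, $\hat T=T\setminus\max(T)$, $\mathrm{dcl}(T)$ is the closure under initial segments, and $\lim(T)$ is the set of $\omega$-sequences $x$ with $x\restriction n\in T$ for infinitely many $n$. $T$ is well founded if $\lim(T)=\emptyset$. A front of $T$ is a $\vartriangleleft$-antichain $F\subseteq T$ such that each $x\in\lim(T)\cup\max(T)$ has an initial segment in $F$. *Tree-creating pairs.* A tree creature at $\eta\in\mathrm{Seq}$ is a triple $t=(\mathrm{nor}[t],\mathrm{val}[t],\mathrm{dis}[t])$,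 where $\mathrm{nor}[t]\ge 0$ is real, $\mathrm{val}[t]$ is a non-empty set of pairs $\langle\eta,\nu\rangle$ with $\eta\vartriangleleft\nu\in\mathrm{Seq}$, $\mathrm{pos}(t)=\mathrm{rng}(\mathrm{val}[t])$ is a $\vartriangleleft$-antichain, and $\mathrm{dis}[t]$ is an arbitrary parameter from a fixed set. A system is a family $\langle s_\nu:\nu\in\hat T\rangle$, $T\subseteq\mathrm{Seq}$ a well-founded quasi tree, where $s_\nu$ is a tree creature at $\nu$ with $\mathrm{pos}(s_\nu)=\mathrm{suc}_T(\nu)$. A tree-creating pair $(K,\Sigma)$ for $\mathbf H$ consists of a set $K$ of tree creatures and a function $\Sigma$ from the countable subsets of $K$ to the subsets of $K$ such that: $\Sigma(\emptyset)=\emptyset$; $t\in\Sigma(\{t\})$ for $t\in K$; if $s\in\Sigma(\mathcal S_s)$ for all $s\in\mathcal S$, then $\Sigma(\mathcal S)\subseteq\Sigma(\bigcup_{s\in\mathcal S}\mathcal S_s)$; if $\Sigma(\mathcal S)\ne\emptyset$, then $\mathcal S=\{s_\nu:\nu\in\hat T\}$ for some system; and each $t\in\Sigma(s_\nu:\nu\in\hat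 T)$ is a tree creature at $\mathrm{root}(T)$ with $\mathrm{pos}(t)\subseteq\max(T)$. The pair is * *bounded* if $\mathrm{nor}[t]\le\sup\{\mathrm{nor}[s_\nu]:(\exists\eta\in\mathrm{pos}(t))\ \nu\vartriangleleft\eta\}$ whenever $t\in\Sigma(s_\nu:\nu\in\hat T)$; * *$2$-big* if for each $t\in K$ with $\mathrm{nor}[t]>1$ and each $h:\mathrm{pos}(t)\to 2$ there is $s\in\Sigma(\{t\})$ with $\mathrm{nor}[s]\ge\mathrm{nor}[t]-1$ and $h$ constant on $\mathrm{pos}(s)$; * *t-omittory* if for each countable system $\langle s_\nu:\nu\in\hat T\rangle\subseteq K$ and each $\nu_0\in\hat T$ with $\mathrm{pos}(s_{\nu_0})\subseteq\max(T)$ there is $s\in\Sigma(s_\nu:\nu\in\hat T)$ with $\mathrm{nor}[s]\ge\mathrm{nor}[s_{\nu_0}]-1$ and $\mathrm{pos}(s)\subseteq\mathrm{pos}(s_{\nu_0})$. *The forcing notions.* For $e<4$, conditions of $\mathbb Q^{\rm tree}_e(K,\Sigma)$ are sequences $p=\langle t_\eta:\eta\in T\rangle$, where $T=T^p\subseteq\mathrm{Seq}$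 is a quasi tree with $\max(T)=\emptyset$, $t_\eta=t^p_\eta\in K$ is a tree creature at $\eta$ with $\mathrm{pos}(t_\eta)=\mathrm{suc}_T(\eta)$, and * $e=0$: $\limsup\langle\mathrm{nor}[t_{x\restriction k}]:x\restriction k\in T\rangle=\infty$ for each $x\in\lim(T)$; * $e=1$: $\langle\mathrm{nor}[t_{x\restriction k}]:x\restriction k\in T\rangle$ diverges to $\infty$ for each $x\in\lim(T)$; * $e=2$: for all $\eta\in T$, $n<\omega$ there is $\nu\in T$ with $\eta\vartriangleleft\nu$ and $\mathrm{nor}[t_\nu]\ge n$; * $e=3$: for all $\eta\in T$, $n<\omega$ there is $\nu\in T$ with $\eta\vartriangleleft\nu$ and $\mathrm{nor}[t_\rho]\ge n$ for all $\rho\in T$ with $\nu\vartriangleleft\rho$. The order: $p\le q$ iff $T^q\subseteq T^p$ and for each $\eta\in T^q$ there is a well-founded quasi tree $T_0\subseteq(T^p)^{[\eta]}$ with $t^q_\eta\in\Sigma(t^p_\nu:\nu\in\hat T_0)$. Put $p^{[\eta]}=\langle t^p_\nu:\nu\in(T^p)^{[\eta]}\rangle$. An $e$-thick antichain of $T^p$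 is a $\vartriangleleft$-antichain $A\subseteq T^p$ such that $A\cap\mathrm{dcl}(T^q)\neq\emptyset$ for all $q\ge p$ in $\mathbb Q^{\rm tree}_e(K,\Sigma)$. Let $F^0_n(p)$ be the set of $\eta\in T^p$ with $\mathrm{nor}[t^p_\eta]>n$ and $\mathrm{nor}[t^p_\nu]\le n$ for all $\nu\in T^p$, $\nu\vartriangleleft\eta$. For $e<3$: $p\le^e_0 q$ means $p\le q$ and $\mathrm{root}(T^p)=\mathrm{root}(T^q)$; $p\le^e_{n+1}q$ means $p\le^e_0q$, and $\nu\in T^q$, $t^q_\nu=t^p_\nu$ whenever $\nu\in T^p$, $\nu\trianglelefteq\eta\in F^0_n(p)$, and, if $e=1$, also $\{t^q_\eta:\eta\in T^q,\ \mathrm{nor}[t^q_\eta]\le n\}\subseteq\{t^p_\eta:\eta\in T^p\}$. **Theorem.** Let $(K,\Sigma)$ be a tree-creating pair for $\mathbf H$. 1. If $e<4$, $\Sigma$ is bounded in case $e=2$, and $\bigcup_{i<\omega}\mathbf H(i)$ is countable, then $\mathbb Q^{\rm tree}_e(K,\Sigma)$ is proper. 2. Let $e<3$, with $\Sigma$ bounded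 in case $e=2$, $p\in\mathbb Q^{\rm tree}_e(K,\Sigma)$, $n<\omega$, and let $\dot\tau_k$ ($k<\omega$) be $\mathbb Q^{\rm tree}_e(K,\Sigma)$-names for ordinals. Then there are a condition $q$ and $e$-thick antichains $A_k$ of $T^q$ such that for each $k$: $(\alpha)$ $p\le^e_nq$; $(\beta)$ for each $\eta\in A_k$ the condition $q^{[\eta]}$ decides the value of $\dot\tau_k$; $(\gamma)$ $(\forall\nu\in A_{k+1})(\exists\eta\in A_k)(\eta\vartriangleleft\nu)$. 3. For $e=3$, $p\in\mathbb Q^{\rm tree}_3(K,\Sigma)$ and names $\dot\tau_k$ for ordinals there are a condition $q\ge p$ and $3$-thick antichains $A_k$ of $T^q$ with $(\beta)$ and $(\gamma)$. 4. If either $e=0$ and $(K,\Sigma)$ is t-omittory, or $e=1$ and $(K,\Sigma)$ is $2$-big, then for $p$, $n$, $\dot\tau_k$ as in 2 there are a condition $q$ and fronts $F_k$ of $T^q$ such that $(\alpha)$, $(\beta)$, $(\gamma)$ hold with $F_k$ in place of $A_k$. -/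

import Mathlib

universe u

/-! ## Forcing notions, names for ordinals, properness

A forcing notion is a type with a relation `≤`; the stronger condition is the larger one. -/

namespace Forcing

/-- `P`-names: a name is a set of pairs `(name, condition)`. -/
inductive PName (P : Type u) : Type (u + 1)
  | mk (ι : Type u) (cond : ι → P) (name : ι → PName P) : PName P

/-- The canonical name of a ground model set: all pairs `(y̌, r)` with `y ∈ x` and `r ∈ P`. -/
def PName.check {P : Type u} : PSet.{u} → PName P
  | ⟨ι, x⟩ => PName.mk (ι × P) (fun i => i.2) (fun i => PName.check (x i.1))

variable {P : Type u} [LE P]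

/-- `ForcesEq σ τ p` is `p ⊩ σ = τ`. Every `q ≥ p` that puts an element into `σ` has an extension
which puts into `τ` an element that it forces to be equal to it, and conversely. -/
def ForcesEq : PName P → PName P → P → Prop
  | ⟨ι, c, x⟩, ⟨κ, d, y⟩ => fun p =>
    (∀ i : ι, ∀ q, p ≤ q → c i ≤ q →
      ∃ r, q ≤ r ∧ ∃ j : κ, d j ≤ r ∧ ForcesEq (x i) (y j) r) ∧
    (∀ j : κ, ∀ q, p ≤ q → d j ≤ q →
      ∃ r, q ≤ r ∧ ∃ i : ι, c i ≤ r ∧ ForcesEq (x i) (y j) r)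

/-- `p` decides the value of `τ`: for some ordinal `o`, `p ⊩ τ = ǒ`. -/
def Decides (p : P) (τ : PName P) : Prop :=
  ∃ o : Ordinal.{u}, ForcesEq τ (PName.check o.toPSet) p

/-- `τ` is a `P`-name for an ordinal: every condition forces `(∃ o ∈ Ord) τ = o`, where the
ordinals of the extension are those of the ground model. -/
def IsOrdinalName (τ : PName P) : Prop :=
  ∀ p : P, ∃ q, p ≤ q ∧ Decides q τ

def Compatible (p q : P) : Prop := ∃ r : P, p ≤ r ∧ q ≤ r

def IsDense (A : Set P) : Prop := ∀ p : P, ∃ d ∈ A, p ≤ d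

/-- Closed unbounded families of countable subsets of `X`. -/
structure IsClubCountable {X : Type u} (𝒞 : Set (Set X)) : Prop where
  countable : ∀ N ∈ 𝒞, N.Countable
  unbounded : ∀ s : Set X, s.Countable → ∃ N ∈ 𝒞, s ⊆ N
  closed : ∀ f : ℕ → Set X, Monotone f → (∀ n, f n ∈ 𝒞) → (⋃ n, f n) ∈ 𝒞

/-- `q` is `(N, P)`-generic, where `N` is a subset of a set `X` which contains, through `i`, all
conditions and all sets of conditions: for each dense set `A ∈ N` the set `A ∩ N` is predense
above `q`. -/
def IsGenericOver {X : Type u} (i : P ⊕ Set P → X) (N : Set X) (q : P) : Prop :=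
  ∀ A : Set P, IsDense A → i (Sum.inr A) ∈ N →
    ∀ r, q ≤ r → ∃ d ∈ A, i (Sum.inl d) ∈ N ∧ Compatible d r

variable (P) in
/-- `P` is proper: for each set `X ⊇ P ∪ 𝒫(P)` (for example `X = H(χ)`), for club many countable
`N ⊆ X`, each `p ∈ P ∩ N` has an `(N, P)`-generic extension. -/
def IsProper : Prop :=
  ∀ (X : Type u) (i : P ⊕ Set P → X), Function.Injective i →
    ∃ 𝒞 : Set (Set X), IsClubCountable 𝒞 ∧
      ∀ N ∈ 𝒞, ∀ p : P, i (Sum.inl p) ∈ N → ∃ q, p ≤ q ∧ IsGenericOver i N q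

end Forcing

/-! ## Quasi trees -/

namespace TreeCreature

open Forcing

variable {α D : Type u}

/-- `ν` is a proper initial segment of `η`. -/
def ProperPrefix (ν η : List α) : Prop := ν <+: η ∧ ν ≠ η

/-- The finite sequences in `⋃ₙ ∏_{i<n} H(i)`. -/
def Seqs (H : ℕ → Set α) : Set (List α) :=
  {η | ∀ (i : ℕ) (h : i < η.length), η[i] ∈ H i}

/-- The restriction `x ↾ n` of an infinite sequence. -/
def initSeg (x : ℕ → α) (n : ℕ) : List α := (List.range n).map x

/-- `r` is the smallest element (the root) of `T`. -/
def IsRoot (T : Set (List α)) (r : List α) : Prop := r ∈ T ∧ ∀ ν ∈ T, r <+: ν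

def IsQuasiTree (T : Set (List α)) : Prop := ∃ r, IsRoot T r

/-- The immediate successors of `η` in `T`. -/
def succs (T : Set (List α)) (η : List α) : Set (List α) :=
  {ν ∈ T | ProperPrefix η ν ∧ ¬ ∃ ρ ∈ T, ProperPrefix η ρ ∧ ProperPrefix ρ ν}

/-- `T^[η]`. -/
def above (T : Set (List α)) (η : List α) : Set (List α) := {ν ∈ T | η <+: ν}

def maxPts (T : Set (List α)) : Set (List α) := {ν ∈ T | ¬ ∃ ρ ∈ T, ProperPrefix ν ρ}

/-- `T̂ = T \ max(T)`. -/
def hat (T : Set (List α)) : Set (List α) := T \ maxPts T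

/-- The infinite branches through `T`. -/
def lim (T : Set (List α)) : Set (ℕ → α) :=
  {x | ∀ m : ℕ, ∃ n, m < n ∧ initSeg x n ∈ T}

def IsWellFoundedTree (T : Set (List α)) : Prop := lim T = ∅

/-- The downward closure. -/
def dcl (T : Set (List α)) : Set (List α) := {ν | ∃ η ∈ T, ν <+: η}

def IsPrefixAntichain (A : Set (List α)) : Prop :=
  ∀ η ∈ A, ∀ ν ∈ A, ¬ ProperPrefix η ν

/-- `F` is a front of the quasi tree `T`. -/
def IsFront (T F : Set (List α)) : Prop :=
  F ⊆ T ∧ IsPrefixAntichain F ∧ (∀ x ∈ lim T, ∃ n, initSeg x n ∈ F) ∧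
    ∀ η ∈ maxPts T, ∃ n, η.take n ∈ F

/-! ## Tree creatures and tree-creating pairs -/

/-- Weak creatures for `H`; `D` is the set of the possible values of the third coordinate. -/
structure WeakCreature (H : ℕ → Set α) (D : Type u) : Type u where
  nor : ℝ
  val : Set (List α × List α)
  dis : D
  nor_nonneg : 0 ≤ nor
  val_nonempty : val.Nonempty
  val_sub : ∀ w ∈ val, w.1 ∈ Seqs H ∧ w.2 ∈ Seqs H ∧ ProperPrefix w.1 w.2

variable {H : ℕ → Set α}

/-- `pos(t) = rng(val[t])`. -/
def WeakCreature.pos (t : WeakCreature H D) : Set (List α) := Prod.snd '' t.val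

/-- `t ∈ TCR_η[H]`. -/
def WeakCreature.IsTreeCreatureAt (t : WeakCreature H D) (η : List α) : Prop :=
  Prod.fst '' t.val = {η} ∧ IsPrefixAntichain t.pos

/-- `T` is a well founded quasi tree of sequences in `⋃ₙ ∏_{i<n} H(i)`, and `⟨s_ν : ν ∈ T̂⟩` is a
system of tree creatures with `s_ν ∈ TCR_ν[H]` and `rng(val[s_ν]) = suc_T(ν)`. -/
structure IsSystem (T : Set (List α)) (s : hat T → WeakCreature H D) : Prop where
  quasi : IsQuasiTree T
  wf : IsWellFoundedTree T
  seqs : T ⊆ Seqs H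
  creature : ∀ ν : hat T, (s ν).IsTreeCreatureAt ν
  pos_eq : ∀ ν : hat T, (s ν).pos = succs T ν

/-- Tree-creating pairs `(K, Σ)` for `H`. The operation `Σ` is defined on the countable subsets of
`K` only; it is extended here by the empty value to all other sets (see `countable`). -/
structure TreeCreatingPair (H : ℕ → Set α) (D : Type u) : Type u where
  K : Set (WeakCreature H D)
  Sig : Set (WeakCreature H D) → Set (WeakCreature H D)
  treeCreature : ∀ t ∈ K, ∃ η, t.IsTreeCreatureAt η
  sig_subset : ∀ S, Sig S ⊆ K
  countable : ∀ S, (Sig S).Nonempty → S ⊆ K ∧ S.Countable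
  trans : ∀ S ⊆ K, S.Countable → ∀ f : WeakCreature H D → Set (WeakCreature H D),
    (∀ s ∈ S, s ∈ Sig (f s)) → Sig S ⊆ Sig (⋃ s ∈ S, f s)
  self_mem : ∀ t ∈ K, t ∈ Sig {t}
  sig_empty : Sig ∅ = ∅
  system : ∀ S, (Sig S).Nonempty →
    ∃ (T : Set (List α)) (s : hat T → WeakCreature H D), IsSystem T s ∧ S = Set.range s
  result : ∀ (T : Set (List α)) (s : hat T → WeakCreature H D), IsSystem T s →
    ∀ t ∈ Sig (Set.range s), (∃ r, IsRoot T r ∧ t.IsTreeCreatureAt r) ∧ t.pos ⊆ maxPts T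

namespace TreeCreatingPair

/-- `Σ` is bounded: `nor[t] ≤ max {nor[s_ν] : (∃ η ∈ rng(val[t])) ν ◁ η}` for each
`t ∈ Σ(s_ν : ν ∈ T̂)`. As the set may be infinite, the maximum is read as the supremum. -/
def IsBounded (C : TreeCreatingPair H D) : Prop :=
  ∀ (T : Set (List α)) (s : hat T → WeakCreature H D), IsSystem T s →
    ∀ t ∈ C.Sig (Set.range s), ∀ c : ℝ,
      (∀ ν : hat T, (∃ η ∈ t.pos, ProperPrefix ν η) → (s ν).nor ≤ c) → t.nor ≤ c

/-- `(K, Σ)` is `k`-big. -/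
def IsBig (C : TreeCreatingPair H D) (k : ℕ) : Prop :=
  ∀ t ∈ C.K, 1 < t.nor → ∀ h : List α → Fin k,
    ∃ s ∈ C.Sig {t}, (∃ c, ∀ ν ∈ s.pos, h ν = c) ∧ t.nor - 1 ≤ s.nor

/-- `(K, Σ)` is t-omittory. (Only countable systems are in the domain of `Σ`.) -/
def IsTOmittory (C : TreeCreatingPair H D) : Prop :=
  ∀ (T : Set (List α)) (s : hat T → WeakCreature H D), IsSystem T s → (hat T).Countable →
    (∀ ν, s ν ∈ C.K) → ∀ ν₀ : hat T, (s ν₀).pos ⊆ maxPts T →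
      ∃ t ∈ C.Sig (Set.range s), (s ν₀).nor - 1 ≤ t.nor ∧ t.pos ⊆ (s ν₀).pos

end TreeCreatingPair

/-! ## The forcing notions `Q^tree_e(K, Σ)` -/

/-- The norm conditions `(c)_e`, `e < 4`, for a system `⟨t_η : η ∈ T⟩`. -/
def NormCond (T : Set (List α)) (t : T → WeakCreature H D) (e : Fin 4) : Prop :=
  match e with
  | 0 => ∀ x ∈ lim T, ∀ (M : ℝ) (m : ℕ), ∃ k, m ≤ k ∧ ∃ h : initSeg x k ∈ T, M < (t ⟨_, h⟩).nor
  | 1 => ∀ x ∈ lim T, ∀ M : ℝ, ∃ m : ℕ, ∀ k, m ≤ k → ∀ h : initSeg x k ∈ T, M < (t ⟨_, h⟩).nor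
  | 2 => ∀ η ∈ T, ∀ n : ℕ, ∃ ν : T, ProperPrefix η ν ∧ (n : ℝ) ≤ (t ν).nor
  | 3 => ∀ η ∈ T, ∀ n : ℕ, ∃ ν ∈ T, ProperPrefix η ν ∧
      ∀ ρ : T, ProperPrefix ν ρ → (n : ℝ) ≤ (t ρ).nor

/-- Conditions of `Q^tree_e(K, Σ)`: sequences `⟨t_η : η ∈ T⟩`. -/
structure QTree (C : TreeCreatingPair H D) (e : Fin 4) : Type u where
  T : Set (List α)
  t : T → WeakCreature H D
  seqs : T ⊆ Seqs H
  quasi : IsQuasiTree T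
  max_empty : maxPts T = ∅
  mem_K : ∀ η, t η ∈ C.K
  creature : ∀ η : T, (t η).IsTreeCreatureAt η
  pos_eq : ∀ η : T, (t η).pos = succs T η
  norm : NormCond T t e

variable {C : TreeCreatingPair H D} {e : Fin 4}

/-- The order of `Q^tree_e(K, Σ)`. -/
instance : LE (QTree C e) where
  le p q := q.T ⊆ p.T ∧ ∀ η : q.T, ∃ T₀ : Set (List α), IsQuasiTree T₀ ∧ IsWellFoundedTree T₀ ∧
    T₀ ⊆ above p.T η ∧ q.t η ∈ C.Sig {c | ∃ ν : p.T, ν.1 ∈ hat T₀ ∧ p.t ν = c}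

theorem initSeg_prefix_of_le (x : ℕ → α) {m n : ℕ} (h : m ≤ n) : initSeg x m <+: initSeg x n := by
  unfold initSeg
  obtain ⟨k, rfl⟩ := Nat.exists_eq_add_of_le h
  rw [List.range_add, List.map_append]
  exact List.prefix_append _ _

theorem succs_above {T : Set (List α)} {η ν : List α} (h : η <+: ν) :
    succs (above T η) ν = succs T ν := by
  ext ρ
  constructor
  · rintro ⟨h1, h2, h3⟩
    exact ⟨h1.1, h2, fun ⟨σ, hσ, a, b⟩ => h3 ⟨σ, ⟨hσ, h.trans a.1⟩, a, b⟩⟩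
  · rintro ⟨h1, h2, h3⟩
    exact ⟨⟨h1, h.trans h2.1⟩, h2, fun ⟨σ, hσ, a, b⟩ => h3 ⟨σ, hσ.1, a, b⟩⟩

theorem prefix_of_mem_lim_above {T : Set (List α)} {η : List α} {x : ℕ → α}
    (hx : x ∈ lim (above T η)) : ∃ m, ∀ k, m ≤ k → η <+: initSeg x k := by
  obtain ⟨n, -, hn⟩ := hx 0
  exact ⟨n, fun k hk => hn.2.trans (initSeg_prefix_of_le x hk)⟩

theorem lim_above_subset {T : Set (List α)} {η : List α} : lim (above T η) ⊆ lim T :=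
  fun _ hx m => (hx m).imp fun _ h => ⟨h.1, h.2.1⟩

theorem normCond_above {T : Set (List α)} {t : T → WeakCreature H D} (h : NormCond T t e)
    (η : List α) : NormCond (above T η) (fun ν => t ⟨ν.1, ν.2.1⟩) e := by
  fin_cases e
  · intro x hx M m
    obtain ⟨m', hm'⟩ := prefix_of_mem_lim_above hx
    obtain ⟨k, hk, hT, hM⟩ := h x (lim_above_subset hx) M (max m m')
    exact ⟨k, (le_max_left _ _).trans hk, ⟨hT, hm' k ((le_max_right _ _).trans hk)⟩, hM⟩
  · intro x hx M
    obtain ⟨m, hm⟩ := h x (lim_above_subset hx) M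
    exact ⟨m, fun k hk hT => hm k hk hT.1⟩
  · intro ν hν n
    obtain ⟨ρ, hρ, hn⟩ := h ν hν.1 n
    exact ⟨⟨ρ.1, ρ.2, hν.2.trans hρ.1⟩, hρ, hn⟩
  · intro ν hν n
    obtain ⟨ρ, hρ, h1, h2⟩ := h ν hν.1 n
    exact ⟨ρ, ⟨hρ, hν.2.trans h1.1⟩, h1, fun σ hσ => h2 ⟨σ.1, σ.2.1⟩ hσ⟩

namespace QTree

/-- `p^[η] = ⟨t^p_ν : ν ∈ (T^p)^[η]⟩`. -/
def restr (p : QTree C e) (η : List α) (hη : η ∈ p.T) : QTree C e where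
  T := above p.T η
  t := fun ν => p.t ⟨ν.1, ν.2.1⟩
  seqs := fun _ h => p.seqs h.1
  quasi := ⟨η, ⟨hη, List.prefix_rfl⟩, fun _ h => h.2⟩
  max_empty := by
    refine Set.eq_empty_of_forall_notMem fun ν hν => ?_
    have h : ν ∈ maxPts p.T :=
      ⟨hν.1.1, fun ⟨ρ, hρ, h⟩ => hν.2 ⟨ρ, ⟨hρ, hν.1.2.trans h.1⟩, h⟩⟩
    rw [p.max_empty] at h
    exact h
  mem_K := fun _ => p.mem_K _
  creature := fun _ => p.creature _
  pos_eq := fun ν => (p.pos_eq _).trans (succs_above ν.2.2).symm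
  norm := normCond_above p.norm η

/-- `F⁰_n(p)`: the minimal nodes among those of norm greater than `n`. -/
def firstNodes (p : QTree C e) (n : ℕ) : Set (List α) :=
  {η | ∃ h : η ∈ p.T, (n : ℝ) < (p.t ⟨η, h⟩).nor ∧
    ∀ ν : p.T, ProperPrefix ν η → (p.t ν).nor ≤ n}

/-- The relations `p ≤ᵉ_n q` (used for `e < 3`). -/
def LEn (n : ℕ) (p q : QTree C e) : Prop :=
  (p ≤ q ∧ ∃ r, IsRoot p.T r ∧ IsRoot q.T r) ∧
  match n with
  | 0 => True
  | m + 1 =>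
    (∀ η ∈ p.firstNodes m, ∀ ν : p.T, ν.1 <+: η → ∃ h : ν.1 ∈ q.T, q.t ⟨ν.1, h⟩ = p.t ν) ∧
    (e = 1 → {c | (∃ η, q.t η = c) ∧ c.nor ≤ m} ⊆ Set.range p.t)

/-- `A` is an `e`-thick antichain of `T^p`. -/
def IsThickAntichain (p : QTree C e) (A : Set (List α)) : Prop :=
  A ⊆ p.T ∧ IsPrefixAntichain A ∧ ∀ q : QTree C e, p ≤ q → (A ∩ dcl q.T).Nonempty

/-- The names `τ_k` are decided along the sets `A_k ⊆ T^q`: `q^[η]` decides `τ_k` for `η ∈ A_k`,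
and each element of `A_{k+1}` properly extends an element of `A_k`. -/
def DecidesAlong (q : QTree C e) (τ : ℕ → PName (QTree C e)) (A : ℕ → Set (List α)) : Prop :=
  ∀ k, (∀ (η : List α) (h : η ∈ q.T), η ∈ A k → Decides (q.restr η h) (τ k)) ∧
    ∀ ν ∈ A (k + 1), ∃ η ∈ A k, ProperPrefix η ν

end QTree

end TreeCreature

open Forcing TreeCreature

/-! A fusion changes a condition step by step, only above a bar: an antichain of nodes that meets
every test, where the tests are the trees of all stronger conditions if thick antichains are wanted,
and the branches if fronts are wanted. The conditions placed above the nodes of the next bar have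
large norms, as far as the norm condition of the limit demands it, and what lies below a bar is not
changed any more, so the limit of a fusion is again a condition. If the `k`-th step decides `τ k`
above its bar, the limit has the required antichains; starting from the bar `firstNodes` gives
`p ≤ᵉ_n q`.

A bar meeting all stronger conditions needs no more than the density of the deciding conditions. For
bars meeting all branches one needs, at every node, a condition with this very root which decides
the name along its branches. A t-omittory pair provides it by leaping from the root to the
successors of a far away node of large norm above which the name is decided. For a `2`-big pair,
above a bad node (one without such a condition) one can shrink the creatures at bad nodes of large
norm so that all their successors are bad, since a creature with only good successors makes its node
good; the resulting condition consists of bad nodes, but some stronger condition decides the name.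

Properness follows by fusing inside a countable model: the `k`-th bar consists of nodes above which
the condition belongs to the model and is stronger than an element, in the model, of the `k`-th
dense set of the model. -/

namespace Forcing

variable {P : Type u} [Preorder P] {p q : P}

theorem ForcesEq.mono (hpq : p ≤ q) : ∀ {σ τ : PName P}, ForcesEq σ τ p → ForcesEq σ τ q
  | ⟨_, _, _⟩, ⟨_, _, _⟩, h => by
    rw [ForcesEq] at h ⊢
    exact ⟨fun i r hr => h.1 i r (hpq.trans hr), fun j r hr => h.2 j r (hpq.trans hr)⟩

theorem Decides.mono (hpq : p ≤ q) {τ : PName P} (h : Decides p τ) : Decides q τ :=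
  h.imp fun _ ho => ho.mono hpq

theorem isClubCountable_closedUnder {X : Type u} {ι : Type*} [Countable ι] (F : ι → X → X → X) :
    IsClubCountable {N : Set X | N.Countable ∧ ∀ i, ∀ x ∈ N, ∀ y ∈ N, F i x y ∈ N} where
  countable := fun _ hN => hN.1
  unbounded := fun s hs => by
    let g (n : ℕ) : Set X := Nat.rec s (fun _ N => N ∪ ⋃ i, Set.image2 (F i) N N) n
    have hg : ∀ n, (g n).Countable := fun n => by
      induction n with
      | zero => exact hs
      | succ n ih => exact ih.union (Set.countable_iUnion fun i => ih.image2 ih _)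
    have hmono : Monotone g := monotone_nat_of_le_succ fun _ => Set.subset_union_left
    refine ⟨⋃ n, g n, ⟨Set.countable_iUnion hg, fun i x hx y hy => ?_⟩, Set.subset_iUnion g 0⟩
    obtain ⟨m, hm⟩ := Set.mem_iUnion.1 hx
    obtain ⟨n, hn⟩ := Set.mem_iUnion.1 hy
    exact Set.mem_iUnion.2 ⟨max m n + 1, .inr (Set.mem_iUnion.2 ⟨i, x,
      hmono (le_max_left m n) hm, y, hmono (le_max_right m n) hn, rfl⟩)⟩
  closed := fun f hf hN => by
    refine ⟨Set.countable_iUnion fun n => (hN n).1, fun i x hx y hy => ?_⟩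
    obtain ⟨m, hm⟩ := Set.mem_iUnion.1 hx
    obtain ⟨n, hn⟩ := Set.mem_iUnion.1 hy
    exact Set.mem_iUnion.2 ⟨max m n, (hN _).2 i x (hf (le_max_left m n) hm) y
      (hf (le_max_right m n) hn)⟩

theorem exists_isClubCountable_reflecting {P X : Type u} {ι : Type*} [Countable ι]
    {i : P ⊕ Set P → X} (hi : Function.Injective i) (R : ι → P → Set P → P → Prop) :
    ∃ 𝒞, IsClubCountable 𝒞 ∧ ∀ N ∈ 𝒞, ∀ j p A d, i (.inl p) ∈ N → i (.inr A) ∈ N → R j p A d →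
      ∃ d', R j p A d' ∧ i (.inl d') ∈ N := by
  have exists_witness (j : ι) (z : P × Set P) : ∃ w, ∀ d, R j z.1 z.2 d → R j z.1 z.2 w := by
    by_cases h : ∃ d, R j z.1 z.2 d
    · exact h.imp fun _ hw _ _ => hw
    · exact ⟨z.1, fun d hd => (h ⟨d, hd⟩).elim⟩
  choose f hf using exists_witness
  let code : P × Set P → X × X := Prod.map (i ∘ .inl) (i ∘ .inr)
  have hcode : Function.Injective code :=
    (hi.comp Sum.inl_injective).prodMap (hi.comp Sum.inr_injective)
  let F (j : ι) (x y : X) : X := Function.extend code (fun z => i (.inl (f j z))) Prod.fst (x, y)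
  refine ⟨_, isClubCountable_closedUnder F, fun N hN j p A d hp hA hd => ?_⟩
  have hF : F j (i (.inl p)) (i (.inr A)) = i (.inl (f j (p, A))) :=
    hcode.extend_apply _ Prod.fst (p, A)
  exact ⟨f j (p, A), hf j (p, A) d hd, hF ▸ hN.2 j _ hp _ hA⟩

end Forcing

namespace TreeCreature

open Forcing

variable {α D : Type u}

section Sequences

variable {ν η ρ r r' : List α} {A S T : Set (List α)} {x : ℕ → α} {m n : ℕ}

theorem properPrefix_iff : ProperPrefix ν η ↔ ν <+: η ∧ ν.length < η.length :=
  and_congr_right fun h =>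
    ⟨fun hne => lt_of_le_of_ne h.length_le fun hl => hne (h.eq_of_length hl),
      fun hl heq => hl.ne (congrArg List.length heq)⟩

theorem ProperPrefix.length_lt (h : ProperPrefix ν η) : ν.length < η.length :=
  (properPrefix_iff.1 h).2

theorem ProperPrefix.trans_isPrefix (h : ProperPrefix ν η) (h' : η <+: ρ) : ProperPrefix ν ρ :=
  properPrefix_iff.2 ⟨h.1.trans h', h.length_lt.trans_le h'.length_le⟩

theorem ProperPrefix.of_isPrefix (h : ν <+: η) (h' : ProperPrefix η ρ) : ProperPrefix ν ρ :=
  properPrefix_iff.2 ⟨h.trans h'.1, h.length_le.trans_lt h'.length_lt⟩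

theorem ProperPrefix.not_isPrefix (h : ProperPrefix ν η) : ¬ η <+: ν :=
  fun h' => h.length_lt.not_ge h'.length_le

theorem isPrefix_or_properPrefix (h : ν <+: ρ) (h' : η <+: ρ) : ν <+: η ∨ ProperPrefix η ν := by
  by_cases hνη : ν <+: η
  · exact .inl hνη
  · exact .inr ⟨(List.prefix_or_prefix_of_prefix h h').resolve_left hνη,
      fun heq => hνη (heq ▸ List.prefix_rfl)⟩

theorem IsPrefixAntichain.eq_of_isPrefix (hA : IsPrefixAntichain A) (hν : ν ∈ A) (hη : η ∈ A)
    (h : ν <+: η) : ν = η :=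
  of_not_not fun hne => hA ν hν η hη ⟨h, hne⟩

theorem IsPrefixAntichain.eq (hA : IsPrefixAntichain A) (hν : ν ∈ A) (hη : η ∈ A) (h : ν <+: ρ)
    (h' : η <+: ρ) : ν = η :=
  (List.prefix_or_prefix_of_prefix h h').elim (hA.eq_of_isPrefix hν hη)
    fun h => (hA.eq_of_isPrefix hη hν h).symm

theorem isPrefixAntichain_singleton (η : List α) : IsPrefixAntichain {η} := by
  rintro _ rfl _ rfl h
  exact h.2 rfl

/-- The upward closure of a set of finite sequences. -/
def ucl (A : Set (List α)) : Set (List α) := {ν | ∃ η ∈ A, η <+: ν}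

theorem subset_ucl : A ⊆ ucl A := fun η hη => ⟨η, hη, List.prefix_rfl⟩

theorem mem_ucl_of_isPrefix (hν : ν ∈ ucl A) (h : ν <+: ρ) : ρ ∈ ucl A :=
  hν.imp fun _ hη => ⟨hη.1, hη.2.trans h⟩

/-- The minimal elements of a set of finite sequences. -/
def minPts (Z : Set (List α)) : Set (List α) := {μ ∈ Z | ∀ ρ ∈ Z, ¬ ProperPrefix ρ μ}

theorem isPrefixAntichain_minPts (Z : Set (List α)) : IsPrefixAntichain (minPts Z) :=
  fun η hη _ hν h => hν.2 η hη.1 h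

theorem subset_ucl_minPts (Z : Set (List α)) : Z ⊆ ucl (minPts Z) := by
  intro μ hμ
  induction hn : μ.length using Nat.strong_induction_on generalizing μ with
  | _ n ih =>
    by_cases h : ∃ ρ ∈ Z, ProperPrefix ρ μ
    · obtain ⟨ρ, hρ, hρμ⟩ := h
      exact mem_ucl_of_isPrefix (ih _ (hn ▸ hρμ.length_lt) hρ rfl) hρμ.1
    · exact ⟨μ, ⟨hμ, fun ρ hρ hρμ => h ⟨ρ, hρ, hρμ⟩⟩, List.prefix_rfl⟩

@[simp] theorem length_initSeg (x : ℕ → α) (n : ℕ) : (initSeg x n).length = n := by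
  simp [initSeg]

theorem eq_initSeg_of_isPrefix (h : ν <+: initSeg x n) : ν = initSeg x ν.length := by
  have hl : ν.length ≤ n := by simpa using h.length_le
  exact (List.prefix_of_prefix_length_le h (initSeg_prefix_of_le x hl) (by simp)).eq_of_length
    (by simp)

theorem initSeg_properPrefix_of_lt (x : ℕ → α) (h : m < n) :
    ProperPrefix (initSeg x m) (initSeg x n) :=
  properPrefix_iff.2 ⟨initSeg_prefix_of_le x h.le, by simpa⟩

theorem lim_mono (h : S ⊆ T) : lim S ⊆ lim T :=
  fun _ hx m => (hx m).imp fun _ hn => ⟨hn.1, h hn.2⟩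

theorem mem_lim_of_forall_mem_iff (hx : x ∈ lim S)
    (h : ∀ k, m ≤ k → (initSeg x k ∈ S ↔ initSeg x k ∈ T)) : x ∈ lim T := by
  intro n
  obtain ⟨k, hk, hkS⟩ := hx (max m n)
  exact ⟨k, (le_max_right m n).trans_lt hk, (h k ((le_max_left m n).trans hk.le)).1 hkS⟩

theorem exists_forall_eq_initSeg (f : ℕ → List α) (hf : ∀ n, ProperPrefix (f n) (f (n + 1))) :
    ∃ x : ℕ → α, ∀ n, n ≤ (f n).length ∧ f n = initSeg x (f n).length := by
  have hlen (n : ℕ) : n ≤ (f n).length :=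
    (strictMono_nat_of_lt_succ fun n => (hf n).length_lt).id_le n
  have hpre {m n : ℕ} (h : m ≤ n) : f m <+: f n := by
    induction n, h using Nat.le_induction with
    | base => exact List.prefix_rfl
    | succ n _ ih => exact ih.trans (hf n).1
  refine ⟨fun i => (f (i + 1))[i]'(hlen (i + 1)), fun n => ⟨hlen n, ?_⟩⟩
  refine List.ext_getElem (by simp) fun i h₁ _ => ?_
  simp only [initSeg, List.getElem_map, List.getElem_range]
  rcases le_total n (i + 1) with h | h
  · exact (hpre h).getElem h₁
  · exact ((hpre h).getElem (hlen (i + 1))).symm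

theorem exists_branch_of_forall_exists_properPrefix (hη : η ∈ S)
    (hS : ∀ ν ∈ S, ∃ μ ∈ S, ProperPrefix ν μ) :
    ∃ x ∈ lim S, ∃ k, η = initSeg x k := by
  choose! g hgS hlt using hS
  have hS (n : ℕ) : g^[n] η ∈ S := by
    induction n with
    | zero => exact hη
    | succ n ih => exact Function.iterate_succ_apply' g n η ▸ hgS _ ih
  obtain ⟨x, hx⟩ := exists_forall_eq_initSeg (fun n => g^[n] η) fun n =>
    Function.iterate_succ_apply' g n η ▸ hlt _ (hS n)
  exact ⟨x, fun m => ⟨_, (hx (m + 1)).1, (hx (m + 1)).2 ▸ hS (m + 1)⟩, _, (hx 0).2⟩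

theorem exists_mem_succs_isPrefix (hρ : ρ ∈ T) (h : ProperPrefix ν ρ) :
    ∃ μ ∈ succs T ν, μ <+: ρ := by
  obtain ⟨μ, hμ, hμρ⟩ := subset_ucl_minPts {σ ∈ T | ProperPrefix ν σ} ⟨hρ, h⟩
  exact ⟨μ, ⟨hμ.1.1, hμ.1.2, fun ⟨σ, hσ, hνσ, hσμ⟩ => hμ.2 σ ⟨hσ, hνσ⟩ hσμ⟩, hμρ⟩

theorem exists_mem_succs (hr : IsRoot T r) (hν : ν ∈ T) (hne : ν ≠ r) :
    ∃ σ ∈ T, ν ∈ succs T σ := by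
  by_contra! hcon
  have key (n : ℕ) : ∃ σ ∈ T, ProperPrefix σ ν ∧ n ≤ σ.length := by
    induction n with
    | zero => exact ⟨r, hr.1, ⟨hr.2 ν hν, hne.symm⟩, Nat.zero_le _⟩
    | succ n ih =>
      obtain ⟨σ, hσ, hσν, hn⟩ := ih
      obtain ⟨μ, hμ, hμν⟩ := exists_mem_succs_isPrefix hν hσν
      exact ⟨μ, hμ.1, ⟨hμν, fun heq => hcon σ hσ (heq ▸ hμ)⟩, hn.trans_lt hμ.2.1.length_lt⟩
  obtain ⟨σ, -, hσν, hle⟩ := key ν.length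
  exact hσν.length_lt.not_ge hle

theorem IsRoot.unique (h : IsRoot T r) (h' : IsRoot T r') : r = r' :=
  (h.2 _ h'.1).eq_of_length_le (h'.2 _ h.1).length_le

theorem mem_hat_iff : ν ∈ hat T ↔ ν ∈ T ∧ ∃ ρ ∈ T, ProperPrefix ν ρ :=
  and_congr_right fun h => ⟨fun h' => of_not_not fun hex => h' ⟨h, hex⟩, fun hex h' => h'.2 hex⟩

theorem IsRoot.mem_hat (h : IsRoot T r) (hν : ν ∈ hat T) : r ∈ hat T :=
  have ⟨_, ρ, hρ, hνρ⟩ := mem_hat_iff.1 hν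
  mem_hat_iff.2 ⟨h.1, ρ, hρ, .of_isPrefix (h.2 ν hν.1) hνρ⟩

end Sequences

namespace WeakCreature

variable {H : ℕ → Set α} {t : WeakCreature H D} {η ν : List α}

theorem pos_nonempty (t : WeakCreature H D) : t.pos.Nonempty := t.val_nonempty.image _

namespace IsTreeCreatureAt

theorem unique (h : t.IsTreeCreatureAt η) (h' : t.IsTreeCreatureAt ν) : η = ν :=
  Set.singleton_eq_singleton_iff.1 (h.1.symm.trans h'.1)

theorem properPrefix (h : t.IsTreeCreatureAt η) (hν : ν ∈ t.pos) : ProperPrefix η ν := by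
  obtain ⟨w, hw, rfl⟩ := hν
  obtain rfl : w.1 = η := h.1.subset (Set.mem_image_of_mem _ hw)
  exact (t.val_sub w hw).2.2

end IsTreeCreatureAt

end WeakCreature

variable {H : ℕ → Set α} {C : TreeCreatingPair H D} {e : Fin 4}

theorem countable_seqs (hH : (⋃ i, H i).Countable) : (Seqs H).Countable := by
  have : Countable (⋃ i, H i : Set α) := hH
  refine (Set.countable_range fun l : List (⋃ i, H i : Set α) => l.map Subtype.val).mono ?_
  intro η hη
  have hmem : ∀ a ∈ η, a ∈ ⋃ i, H i := by
    intro a ha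
    obtain ⟨i, hi, rfl⟩ := List.getElem_of_mem ha
    exact Set.mem_iUnion.2 ⟨i, hη i hi⟩
  exact ⟨η.attach.map fun a => ⟨a.1, hmem a.1 a.2⟩, by simp [Function.comp_def]⟩

namespace QTree

variable {p q : QTree C e} {c : WeakCreature H D} {A T : Set (List α)} {ν η ρ : List α}

open Classical in
/-- The creature of `p` at `ν`; the value is arbitrary for `ν ∉ T^p`. -/
noncomputable def cr (p : QTree C e) (ν : List α) : WeakCreature H D :=
  if h : ν ∈ p.T then p.t ⟨ν, h⟩ else p.t ⟨p.quasi.choose, p.quasi.choose_spec.1⟩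

theorem cr_of_mem (h : ν ∈ p.T) : p.cr ν = p.t ⟨ν, h⟩ := dif_pos h

theorem cr_coe (ν : p.T) : p.cr ν = p.t ν := cr_of_mem ν.2

theorem cr_mem_K (p : QTree C e) (ν : List α) : p.cr ν ∈ C.K := by
  unfold cr
  split_ifs <;> exact p.mem_K _

theorem cr_creature (h : ν ∈ p.T) : (p.cr ν).IsTreeCreatureAt ν :=
  cr_of_mem h ▸ p.creature ⟨ν, h⟩

theorem pos_cr (h : ν ∈ p.T) : (p.cr ν).pos = succs p.T ν := cr_of_mem h ▸ p.pos_eq ⟨ν, h⟩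

theorem pos_cr_subset (h : ν ∈ p.T) : (p.cr ν).pos ⊆ p.T :=
  (pos_cr h).subset.trans fun _ hμ => hμ.1

theorem exists_pos_cr_isPrefix (hν : ν ∈ p.T) (hρ : ρ ∈ p.T) (h : ProperPrefix ν ρ) :
    ∃ μ ∈ (p.cr ν).pos, μ <+: ρ :=
  pos_cr hν ▸ exists_mem_succs_isPrefix hρ h

theorem exists_mem_properPrefix (h : ν ∈ p.T) : ∃ μ ∈ p.T, ProperPrefix ν μ := by
  obtain ⟨μ, hμ⟩ := (p.cr ν).pos_nonempty
  exact ⟨μ, pos_cr_subset h hμ, (cr_creature h).properPrefix hμ⟩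

theorem normCond_cr (p : QTree C e) : NormCond p.T (fun ν => p.cr ν) e := by
  simpa only [cr_coe] using p.norm

theorem ext_cr (hT : p.T = q.T) (hcr : ∀ ν ∈ p.T, p.cr ν = q.cr ν) : p = q := by
  have ht (ν : List α) (h : ν ∈ p.T) (h' : ν ∈ q.T) : p.t ⟨ν, h⟩ = q.t ⟨ν, h'⟩ := by
    rw [← cr_of_mem h, ← cr_of_mem h', hcr ν h]
  cases p
  cases q
  dsimp only at hT ht
  subst hT
  congr
  exact funext fun ν => ht ν.1 ν.2 ν.2

/-- The creatures that `Σ` yields from creatures of `p`. -/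
def gens (p : QTree C e) : Set (WeakCreature H D) := {c | ∃ A ⊆ p.T, c ∈ C.Sig (p.cr '' A)}

theorem gens_subset_K (p : QTree C e) : p.gens ⊆ C.K := by
  rintro c ⟨A, -, hc⟩
  exact C.sig_subset _ hc

theorem sig_singleton_subset_gens (h : ν ∈ p.T) : C.Sig {p.cr ν} ⊆ p.gens :=
  fun c hc => ⟨{ν}, by simpa using h, by simpa using hc⟩

theorem cr_mem_gens (h : ν ∈ p.T) : p.cr ν ∈ p.gens :=
  sig_singleton_subset_gens h (C.self_mem _ (p.cr_mem_K ν))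

theorem exists_system_of_mem_sig (hA : A ⊆ p.T) (hc : c ∈ C.Sig (p.cr '' A)) :
    ∃ T ⊆ p.T, hat T = A ∧ IsSystem T fun ν : hat T => p.cr ν := by
  obtain ⟨T, s, hs, hAs⟩ := C.system _ ⟨c, hc⟩
  have hs_cr (ν : hat T) : ν.1 ∈ A ∧ s ν = p.cr ν := by
    obtain ⟨μ, hμ, heq⟩ := hAs.superset (Set.mem_range_self ν)
    obtain rfl : μ = ν.1 := (cr_creature (hA hμ)).unique (heq ▸ hs.creature ν)
    exact ⟨hμ, heq.symm⟩
  have hatT : hat T = A := by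
    refine Set.Subset.antisymm (fun ν hν => (hs_cr ⟨ν, hν⟩).1) fun ν hν => ?_
    obtain ⟨μ, hμ⟩ := hAs.subset (Set.mem_image_of_mem _ hν)
    obtain rfl : μ.1 = ν := (hs.creature μ).unique (hμ ▸ cr_creature (hA hν))
    exact μ.2
  have hne : (hat T).Nonempty := by
    rw [hatT, ← Set.image_nonempty (f := p.cr), Set.nonempty_iff_ne_empty]
    intro h
    simp [h, C.sig_empty] at hc
  obtain ⟨r, hr⟩ := hs.quasi
  refine ⟨T, fun ν hν => ?_, hatT, (funext fun ν => (hs_cr ν).2 : s = _) ▸ hs⟩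
  by_cases hνr : ν = r
  · exact hνr ▸ hA (hatT ▸ hr.mem_hat hne.choose_spec)
  · obtain ⟨σ, hσ, hσν⟩ := exists_mem_succs hr hν hνr
    have hσh : σ ∈ hat T := mem_hat_iff.2 ⟨hσ, ν, hν, hσν.2.1⟩
    rw [← hs.pos_eq ⟨σ, hσh⟩, (hs_cr _).2] at hσν
    exact pos_cr_subset (hA (hatT ▸ hσh)) hσν

theorem exists_system_of_mem_gens (hc : c ∈ p.gens) :
    ∃ T ⊆ p.T, (IsSystem T fun ν : hat T => p.cr ν) ∧ c ∈ C.Sig (p.cr '' hat T) := by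
  obtain ⟨A, hA, hc⟩ := hc
  obtain ⟨T, hT, rfl, hs⟩ := exists_system_of_mem_sig hA hc
  exact ⟨T, hT, hs, hc⟩

theorem result_of_isSystem (hs : IsSystem T fun ν : hat T => p.cr ν)
    (hc : c ∈ C.Sig (p.cr '' hat T)) :
    (∃ r, IsRoot T r ∧ c.IsTreeCreatureAt r) ∧ c.pos ⊆ maxPts T :=
  C.result T _ hs c (Set.image_eq_range p.cr (hat T) ▸ hc)

theorem pos_subset_of_mem_gens (hc : c ∈ p.gens) : c.pos ⊆ p.T := by
  obtain ⟨T, hT, hs, hcT⟩ := exists_system_of_mem_gens hc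
  exact fun μ hμ => hT ((result_of_isSystem hs hcT).2 hμ).1

theorem isTreeCreatureAt_of_mem_sig (h : ν ∈ p.T) (hc : c ∈ C.Sig {p.cr ν}) :
    c.IsTreeCreatureAt ν := by
  rw [← Set.image_singleton] at hc
  obtain ⟨T, -, hT, hs⟩ := exists_system_of_mem_sig (by simpa using h) hc
  obtain ⟨r, hr, hcr⟩ := (result_of_isSystem hs (hT ▸ hc)).1
  obtain rfl : r = ν := hT.subset (hr.mem_hat (hT.superset rfl))
  exact hcr

theorem setOf_t_eq_image_cr (hT : T ⊆ p.T) :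
    {c | ∃ ν : p.T, ν.1 ∈ hat T ∧ p.t ν = c} = p.cr '' hat T := by
  ext c
  constructor
  · rintro ⟨ν, hν, rfl⟩
    exact ⟨ν, hν, cr_coe ν⟩
  · rintro ⟨ν, hν, rfl⟩
    exact ⟨⟨ν, hT hν.1⟩, hν, (cr_of_mem _).symm⟩

theorem le_iff : p ≤ q ↔ q.T ⊆ p.T ∧ ∀ ν ∈ q.T, q.cr ν ∈ p.gens := by
  refine and_congr_right fun _ => ⟨fun h ν hν => ?_, fun h ν => ?_⟩
  · obtain ⟨T, -, -, hT, hc⟩ := h ⟨ν, hν⟩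
    have hTp : T ⊆ p.T := fun μ hμ => (hT hμ).1
    rw [setOf_t_eq_image_cr hTp, ← cr_of_mem] at hc
    exact ⟨hat T, fun μ hμ => hTp hμ.1, hc⟩
  · obtain ⟨T, hTp, hs, hc⟩ := exists_system_of_mem_gens (h ν ν.2)
    obtain ⟨r, hr, hrc⟩ := (result_of_isSystem hs hc).1
    obtain rfl : r = ν := hrc.unique (cr_creature ν.2)
    refine ⟨T, hs.quasi, hs.wf, fun μ hμ => ⟨hTp hμ, hr.2 μ hμ⟩, ?_⟩
    rwa [setOf_t_eq_image_cr hTp, ← cr_coe]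

theorem T_subset (h : p ≤ q) : q.T ⊆ p.T := h.1

theorem cr_mem_gens_of_le (h : p ≤ q) (hν : ν ∈ q.T) : q.cr ν ∈ p.gens := (le_iff.1 h).2 ν hν

theorem gens_subset_of_le (h : p ≤ q) : q.gens ⊆ p.gens := by
  rintro c ⟨A, hA, hc⟩
  have hex : ∀ s ∈ q.cr '' A, ∃ B ⊆ p.T, s ∈ C.Sig (p.cr '' B) := by
    rintro _ ⟨ν, hν, rfl⟩
    exact cr_mem_gens_of_le h (hA hν)
  choose! B hB hsB using hex
  obtain ⟨hK, hcount⟩ := C.countable _ ⟨c, hc⟩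
  refine ⟨⋃ s ∈ q.cr '' A, B s, Set.iUnion₂_subset hB, ?_⟩
  rw [Set.image_iUnion₂]
  exact C.trans _ hK hcount (fun s => p.cr '' B s) hsB hc

instance : Preorder (QTree C e) where
  le_refl _ := le_iff.2 ⟨subset_rfl, fun _ => cr_mem_gens⟩
  le_trans _ _ _ h h' := le_iff.2 ⟨(T_subset h').trans (T_subset h), fun _ hν =>
    gens_subset_of_le h (cr_mem_gens_of_le h' hν)⟩

theorem isRoot_of_le (hν : IsRoot p.T ν) (h : p ≤ q) (hνq : ν ∈ q.T) : IsRoot q.T ν :=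
  ⟨hνq, fun ρ hρ => hν.2 ρ (T_subset h hρ)⟩

theorem cr_restr {hη : η ∈ p.T} (hν : ν ∈ (p.restr η hη).T) : (p.restr η hη).cr ν = p.cr ν := by
  rw [cr_of_mem hν, cr_of_mem hν.1]
  rfl

theorem isRoot_restr (hη : η ∈ p.T) : IsRoot (p.restr η hη).T η :=
  ⟨⟨hη, List.prefix_rfl⟩, fun _ h => h.2⟩

theorem le_restr (hη : η ∈ p.T) : p ≤ p.restr η hη :=
  le_iff.2 ⟨fun _ hν => hν.1, fun _ hν => cr_restr hν ▸ cr_mem_gens hν.1⟩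

theorem mem_gens_restr (hη : η ∈ p.T) (hc : c ∈ p.gens) (hcν : c.IsTreeCreatureAt ν)
    (hην : η <+: ν) : c ∈ (p.restr η hη).gens := by
  obtain ⟨T, hT, hs, hcT⟩ := exists_system_of_mem_gens hc
  obtain ⟨r, hr, hrc⟩ := (result_of_isSystem hs hcT).1
  obtain rfl := hrc.unique hcν
  have hat_subset : hat T ⊆ (p.restr η hη).T := fun ρ hρ => ⟨hT hρ.1, hην.trans (hr.2 ρ hρ.1)⟩
  refine ⟨hat T, hat_subset, ?_⟩
  rwa [Set.image_congr fun ρ hρ => cr_restr (hat_subset hρ)]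

theorem restr_le (h : p ≤ q) (hη : η ∈ p.T) (hq : ∀ ν ∈ q.T, η <+: ν) : p.restr η hη ≤ q :=
  le_iff.2 ⟨fun ν hν => ⟨T_subset h hν, hq ν hν⟩, fun ν hν =>
    mem_gens_restr hη (cr_mem_gens_of_le h hν) (cr_creature hν) (hq ν hν)⟩

theorem restr_le_restr (h : p ≤ q) (hη : η ∈ p.T) (hν : ν ∈ q.T) (hην : η <+: ν) :
    p.restr η hη ≤ q.restr ν hν :=
  restr_le (h.trans (le_restr hν)) hη fun _ hρ => hην.trans hρ.2

theorem restr_root {r : List α} (hr : IsRoot p.T r) : p.restr r hr.1 = p :=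
  ext_cr (Set.ext fun ν => ⟨fun h => h.1, fun h => ⟨h, hr.2 ν h⟩⟩) fun _ hν => cr_restr hν

theorem exists_branch (hν : ν ∈ p.T) : ∃ x ∈ lim p.T, ∃ k, ν = initSeg x k :=
  exists_branch_of_forall_exists_properPrefix hν fun _ => exists_mem_properPrefix

section Constructions

variable {s : WeakCreature H D} {c σ : List α → WeakCreature H D} {f : List α → QTree C e}
  {S : Set (List α)}

/-- The creatures `⟨c ν : ν ∈ T⟩` satisfy all requirements on a condition stronger than `p`, except
possibly the norm condition. -/
structure IsReplacement (p : QTree C e) (T : Set (List α)) (c : List α → WeakCreature H D) :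
    Prop where
  subset : T ⊆ p.T
  quasi : IsQuasiTree T
  mem_gens : ∀ ν ∈ T, c ν ∈ p.gens
  creature : ∀ ν ∈ T, (c ν).IsTreeCreatureAt ν
  pos_subset : ∀ ν ∈ T, (c ν).pos ⊆ T
  exists_pos_isPrefix : ∀ ν ∈ T, ∀ ρ ∈ T, ProperPrefix ν ρ → ∃ μ ∈ (c ν).pos, μ <+: ρ

namespace IsReplacement

theorem pos_eq_succs (h : p.IsReplacement T c) (hν : ν ∈ T) : (c ν).pos = succs T ν := by
  have hlt {μ : List α} (hμ : μ ∈ (c ν).pos) := (h.creature ν hν).properPrefix hμ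
  ext μ
  refine ⟨fun hμ => ⟨h.pos_subset ν hν hμ, hlt hμ, ?_⟩, fun ⟨hμ, hνμ, hmin⟩ => ?_⟩
  · rintro ⟨ρ, hρ, hνρ, hρμ⟩
    obtain ⟨σ, hσ, hσρ⟩ := h.exists_pos_isPrefix ν hν ρ hρ hνρ
    exact (h.creature ν hν).2 σ hσ μ hμ (.of_isPrefix hσρ hρμ)
  · obtain ⟨σ, hσ, hσμ⟩ := h.exists_pos_isPrefix ν hν μ hμ hνμ
    obtain rfl : σ = μ := of_not_not fun hne => hmin ⟨σ, h.pos_subset ν hν hσ, hlt hσ, hσμ, hne⟩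
    exact hσ

theorem exists_condition (h : p.IsReplacement T c) (hnorm : NormCond T (fun ν => c ν) e) :
    ∃ q, p ≤ q ∧ q.T = T ∧ ∀ ν ∈ T, q.cr ν = c ν := by
  have max_empty : maxPts T = ∅ := by
    refine Set.eq_empty_of_forall_notMem fun ν hν => hν.2 ?_
    obtain ⟨μ, hμ⟩ := (c ν).pos_nonempty
    exact ⟨μ, h.pos_subset ν hν.1 hμ, (h.creature ν hν.1).properPrefix hμ⟩
  let q : QTree C e := ⟨T, fun ν => c ν, h.subset.trans p.seqs, h.quasi, max_empty,
    fun ν => p.gens_subset_K (h.mem_gens ν ν.2), fun ν => h.creature ν ν.2,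
    fun ν => h.pos_eq_succs ν.2, hnorm⟩
  have hq (ν : List α) (hν : ν ∈ T) : q.cr ν = c ν := cr_of_mem hν
  exact ⟨q, le_iff.2 ⟨h.subset, fun ν hν => hq ν hν ▸ h.mem_gens ν hν⟩, rfl, hq⟩

end IsReplacement

/-- The family `⟨c ν : ν ∈ T⟩` agrees with `p` at the sequence `ρ`. -/
def AgreesAt (p : QTree C e) (T : Set (List α)) (c : List α → WeakCreature H D) (ρ : List α) :
    Prop :=
  (ρ ∈ T ↔ ρ ∈ p.T) ∧ (ρ ∈ T → c ρ = p.cr ρ)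

theorem normCond_of_agreesAt
    (hlim : ∀ x ∈ lim T, ∃ (p : QTree C e) (m : ℕ), ∀ k, m ≤ k → p.AgreesAt T c (initSeg x k))
    (hcone : ∀ ν ∈ T, ∃ (p : QTree C e), ∃ μ ∈ T, ν <+: μ ∧ ∀ ρ, μ <+: ρ → p.AgreesAt T c ρ) :
    NormCond T (fun ν => c ν) e := by
  have hlim' (x : ℕ → α) (hx : x ∈ lim T) : ∃ (p : QTree C e) (m : ℕ), x ∈ lim p.T ∧
      ∀ k, m ≤ k → p.AgreesAt T c (initSeg x k) := by
    obtain ⟨p, m, hm⟩ := hlim x hx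
    exact ⟨p, m, mem_lim_of_forall_mem_iff hx fun k hk => (hm k hk).1, hm⟩
  fin_cases e
  · intro x hx M m
    obtain ⟨p, m', hxp, hm⟩ := hlim' x hx
    obtain ⟨k, hk, hkp, hM⟩ := p.normCond_cr x hxp M (max m m')
    have ⟨hiff, hcr⟩ := hm k ((le_max_right m m').trans hk)
    exact ⟨k, (le_max_left m m').trans hk, hiff.2 hkp, hM.trans_eq
      (congrArg _ (hcr (hiff.2 hkp)).symm)⟩
  · intro x hx M
    obtain ⟨p, m', hxp, hm⟩ := hlim' x hx
    obtain ⟨m, hM⟩ := p.normCond_cr x hxp M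
    refine ⟨max m m', fun k hk hkT => ?_⟩
    have ⟨hiff, hcr⟩ := hm k ((le_max_right m m').trans hk)
    exact (hM k ((le_max_left m m').trans hk) (hiff.1 hkT)).trans_eq
      (congrArg _ (hcr hkT).symm)
  · intro ν hν n
    obtain ⟨p, μ, hμ, hνμ, hagree⟩ := hcone ν hν
    obtain ⟨⟨ρ, hρ⟩, hμρ, hn⟩ := p.normCond_cr μ ((hagree μ List.prefix_rfl).1.1 hμ) n
    have ⟨hiff, hcr⟩ := hagree ρ hμρ.1
    exact ⟨⟨ρ, hiff.2 hρ⟩, .of_isPrefix hνμ hμρ, hn.trans_eq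
      (congrArg _ (hcr (hiff.2 hρ)).symm)⟩
  · intro ν hν n
    obtain ⟨p, μ, hμ, hνμ, hagree⟩ := hcone ν hν
    obtain ⟨ρ, hρ, hμρ, hn⟩ := p.normCond_cr μ ((hagree μ List.prefix_rfl).1.1 hμ) n
    refine ⟨ρ, (hagree ρ hμρ.1).1.2 hρ, .of_isPrefix hνμ hμρ, fun ⟨π, hπ⟩ hρπ => ?_⟩
    have ⟨hiff, hcr⟩ := hagree π (hμρ.1.trans hρπ.1)
    exact (hn ⟨π, hiff.1 hπ⟩ hρπ).trans_eq (congrArg _ (hcr hπ).symm)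

open Classical in
/-- The condition which describes, at `ν`, the result of replacing the part of `p` above each
element `η` of the antichain `A` by `f η`. -/
noncomputable def piece (p : QTree C e) (A : Set (List α)) (f : List α → QTree C e) (ν : List α) :
    QTree C e :=
  if h : ν ∈ ucl A then f h.choose else p

theorem piece_of_isPrefix (hA : IsPrefixAntichain A) (hη : η ∈ A) (h : η <+: ν) :
    p.piece A f ν = f η := by
  have hex : ν ∈ ucl A := ⟨η, hη, h⟩
  have heq : hex.choose = η := hA.eq hex.choose_spec.1 hη hex.choose_spec.2 h
  rw [piece, dif_pos hex, heq]

theorem piece_of_notMem (h : ν ∉ ucl A) : p.piece A f ν = p := dif_neg h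

/-- The tree of the condition that results from replacing the part of `p` above each element `η` of
the antichain `A` by `f η`. -/
def glueTree (p : QTree C e) (A : Set (List α)) (f : List α → QTree C e) : Set (List α) :=
  {ν | ν ∈ (p.piece A f ν).T}

theorem agreesAt_piece (ν : List α) :
    (p.piece A f ν).AgreesAt (p.glueTree A f) (fun ν => (p.piece A f ν).cr ν) ν :=
  ⟨Iff.rfl, fun _ => rfl⟩

theorem mem_glueTree_iff_of_isPrefix (hA : IsPrefixAntichain A) (hη : η ∈ A) (h : η <+: ν) :
    ν ∈ p.glueTree A f ↔ ν ∈ (f η).T := by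
  rw [glueTree, Set.mem_ofPred_eq, piece_of_isPrefix hA hη h]

theorem mem_glueTree_iff_of_notMem (h : ν ∉ ucl A) : ν ∈ p.glueTree A f ↔ ν ∈ p.T := by
  rw [glueTree, Set.mem_ofPred_eq, piece_of_notMem h]

theorem isReplacement_glueTree (hAp : A ⊆ p.T) (hA : IsPrefixAntichain A)
    (hroot : ∀ η ∈ A, IsRoot (f η).T η) (hle : ∀ η ∈ A, p ≤ f η) :
    p.IsReplacement (p.glueTree A f) (fun ν => (p.piece A f ν).cr ν) := by
  have hp_le (ν : List α) : p ≤ p.piece A f ν := by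
    by_cases hν : ν ∈ ucl A
    · obtain ⟨η, hη, hην⟩ := hν
      exact piece_of_isPrefix hA hη hην ▸ hle η hη
    · exact (piece_of_notMem hν).ge
  have hsub : p.glueTree A f ⊆ p.T := fun ν hν => T_subset (hp_le ν) hν
  have hA_mem : A ⊆ p.glueTree A f := fun η hη =>
    (mem_glueTree_iff_of_isPrefix hA hη List.prefix_rfl).2 (hroot η hη).1
  obtain ⟨r, hr⟩ := p.quasi
  refine ⟨hsub, ⟨r, ?_, fun ν hν => hr.2 ν (hsub hν)⟩,
    fun ν hν => cr_mem_gens_of_le (hp_le ν) hν, fun ν hν => cr_creature hν,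
    fun ν hν μ hμ => ?_, fun ν hν ρ hρ hνρ => ?_⟩
  · by_cases hrA : r ∈ ucl A
    · obtain ⟨η, hη, hηr⟩ := hrA
      exact hA_mem (hηr.eq_of_length_le (hr.2 η (hAp hη)).length_le ▸ hη)
    · exact (mem_glueTree_iff_of_notMem hrA).2 hr.1
  · have hνμ := (cr_creature hν).properPrefix hμ
    have hμp := pos_cr_subset hν hμ
    by_cases hνA : ν ∈ ucl A
    · obtain ⟨η, hη, hην⟩ := hνA
      rw [piece_of_isPrefix hA hη hην] at hμp
      exact (mem_glueTree_iff_of_isPrefix hA hη (hην.trans hνμ.1)).2 hμp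
    · rw [piece_of_notMem hνA] at hμ hμp
      by_cases hμA : μ ∈ ucl A
      · obtain ⟨η, hη, hημ⟩ := hμA
        have hνη := (isPrefix_or_properPrefix hημ hνμ.1).resolve_left fun h => hνA ⟨η, hη, h⟩
        obtain ⟨π, hπ, hπη⟩ := exists_pos_cr_isPrefix (hsub hν) (hAp hη) hνη
        obtain rfl : π = μ := (cr_creature (hsub hν)).2.eq_of_isPrefix hπ hμ (hπη.trans hημ)
        exact hA_mem (hημ.eq_of_length_le hπη.length_le ▸ hη)
      · exact (mem_glueTree_iff_of_notMem hμA).2 hμp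
  · by_cases hνA : ν ∈ ucl A
    · obtain ⟨η, hη, hην⟩ := hνA
      have hρη := (mem_glueTree_iff_of_isPrefix hA hη (hην.trans hνρ.1)).1 hρ
      refine exists_pos_cr_isPrefix hν ?_ hνρ
      rwa [piece_of_isPrefix hA hη hην]
    · refine exists_pos_cr_isPrefix hν ?_ hνρ
      rw [piece_of_notMem hνA]
      exact hsub hρ

theorem normCond_glueTree (hA : IsPrefixAntichain A) (hroot : ∀ η ∈ A, IsRoot (f η).T η) :
    NormCond (p.glueTree A f) (fun ν => (p.piece A f ν).cr ν) e := by
  have hf (η : List α) (hη : η ∈ A) (ρ : List α) (hρ : η <+: ρ) :=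
    piece_of_isPrefix hA hη hρ ▸ agreesAt_piece (p := p) (A := A) (f := f) ρ
  have hp (ρ : List α) (hρ : ρ ∉ ucl A) :=
    piece_of_notMem hρ ▸ agreesAt_piece (p := p) (A := A) (f := f) ρ
  refine normCond_of_agreesAt (C := C) (c := fun ν => (p.piece A f ν).cr ν) (fun x _ => ?_)
    fun ν hν => ?_
  · by_cases hx : ∃ m, initSeg x m ∈ ucl A
    · obtain ⟨m, η, hη, hηx⟩ := hx
      exact ⟨f η, m, fun k hk => hf η hη _ (hηx.trans (initSeg_prefix_of_le x hk))⟩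
    · exact ⟨p, 0, fun k _ => hp _ fun hk => hx ⟨k, hk⟩⟩
  · by_cases hνA : ν ∈ ucl A
    · obtain ⟨η, hη, hην⟩ := hνA
      exact ⟨f η, ν, hν, List.prefix_rfl, fun ρ hρ => hf η hη ρ (hην.trans hρ)⟩
    by_cases hex : ∃ η ∈ A, ν <+: η
    · obtain ⟨η, hη, hνη⟩ := hex
      exact ⟨f η, η, (mem_glueTree_iff_of_isPrefix hA hη List.prefix_rfl).2 (hroot η hη).1, hνη,
        hf η hη⟩
    · refine ⟨p, ν, hν, List.prefix_rfl, fun ρ hνρ => hp ρ ?_⟩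
      rintro ⟨η, hη, hηρ⟩
      exact (List.prefix_or_prefix_of_prefix hηρ hνρ).elim (fun h => hνA ⟨η, hη, h⟩)
        fun h => hex ⟨η, hη, h⟩

theorem exists_glue (hAp : A ⊆ p.T) (hA : IsPrefixAntichain A)
    (hroot : ∀ η ∈ A, IsRoot (f η).T η) (hle : ∀ η ∈ A, p ≤ f η) :
    ∃ q, p ≤ q ∧ (∀ ν ∈ p.T, ν ∉ ucl A → ν ∈ q.T ∧ q.cr ν = p.cr ν) ∧
      ∀ η ∈ A, ∃ h, q.restr η h = f η := by
  obtain ⟨q, hpq, hqT, hqcr⟩ :=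
    (isReplacement_glueTree hAp hA hroot hle).exists_condition (normCond_glueTree hA hroot)
  refine ⟨q, hpq, fun ν hν hνA => ?_, fun η hη => ?_⟩
  · have hνT := (mem_glueTree_iff_of_notMem (f := f) hνA).2 hν
    exact ⟨hqT ▸ hνT, (hqcr ν hνT).trans (by rw [piece_of_notMem hνA])⟩
  · have hmem {ν : List α} (hην : η <+: ν) : ν ∈ q.T ↔ ν ∈ (f η).T := by
      rw [hqT, mem_glueTree_iff_of_isPrefix hA hη hην]
    have hηq : η ∈ q.T := (hmem List.prefix_rfl).2 (hroot η hη).1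
    refine ⟨hηq, ext_cr (Set.ext fun ν => ⟨fun h => (hmem h.2).1 h.1, fun h => ?_⟩) fun ν hν => ?_⟩
    · have hην := (hroot η hη).2 ν h
      exact ⟨(hmem hην).2 h, hην⟩
    · rw [cr_restr hν, hqcr ν (hqT ▸ hν.1), piece_of_isPrefix hA hη hν.2]

theorem mem_of_mem_gens (hs : s ∈ p.gens) (hsν : s.IsTreeCreatureAt ν) : ν ∈ p.T := by
  obtain ⟨T, hT, hsys, hsT⟩ := exists_system_of_mem_gens hs
  obtain ⟨r, hr, hsr⟩ := (result_of_isSystem hsys hsT).1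
  exact hsr.unique hsν ▸ hT hr.1

open Classical in
theorem isReplacement_update (hs : s ∈ p.gens) (hsν : s.IsTreeCreatureAt ν) :
    p.IsReplacement (insert ν (p.T ∩ ucl s.pos)) (Function.update p.cr ν s) := by
  have hlt {ρ : List α} (hρ : ρ ∈ ucl s.pos) : ProperPrefix ν ρ :=
    have ⟨_, hμ, hμρ⟩ := hρ
    (hsν.properPrefix hμ).trans_isPrefix hμρ
  have hcr {ρ : List α} (hρ : ρ ∈ ucl s.pos) : Function.update p.cr ν s ρ = p.cr ρ :=
    Function.update_of_ne (hlt hρ).2.symm _ _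
  have hpos_sub : s.pos ⊆ p.T ∩ ucl s.pos :=
    Set.subset_inter (pos_subset_of_mem_gens hs) subset_ucl
  refine ⟨Set.insert_subset (mem_of_mem_gens hs hsν) Set.inter_subset_left,
    ⟨ν, Set.mem_insert _ _, ?_⟩, ?_, ?_, ?_, ?_⟩
  · rintro ρ (rfl | ⟨-, hρ⟩)
    exacts [List.prefix_rfl, (hlt hρ).1]
  · rintro ρ (rfl | ⟨hρp, hρ⟩)
    · rwa [Function.update_self]
    · exact hcr hρ ▸ cr_mem_gens hρp
  · rintro ρ (rfl | ⟨hρp, hρ⟩)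
    · rwa [Function.update_self]
    · exact hcr hρ ▸ cr_creature hρp
  · rintro ρ (rfl | ⟨hρp, hρ⟩) μ hμ
    · rw [Function.update_self] at hμ
      exact .inr (hpos_sub hμ)
    · rw [hcr hρ] at hμ
      exact .inr ⟨pos_cr_subset hρp hμ,
        mem_ucl_of_isPrefix hρ ((cr_creature hρp).properPrefix hμ).1⟩
  · rintro ρ (rfl | ⟨hρp, hρ⟩) π (rfl | ⟨hπp, hπ⟩) hρπ
    · exact (hρπ.2 rfl).elim
    · rwa [Function.update_self]
    · exact (hρπ.not_isPrefix (hlt hρ).1).elim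
    · exact hcr hρ ▸ exists_pos_cr_isPrefix hρp hπp hρπ

open Classical in
theorem exists_replaceRoot (hs : s ∈ p.gens) (hsν : s.IsTreeCreatureAt ν) :
    ∃ q, p ≤ q ∧ IsRoot q.T ν ∧ q.cr ν = s ∧
      ∀ μ ∈ s.pos, ∃ h h', q.restr μ h = p.restr μ h' := by
  have hrepl := isReplacement_update hs hsν
  set T := insert ν (p.T ∩ ucl s.pos)
  have hne {ρ : List α} (hρ : ρ ∈ ucl s.pos) : ρ ≠ ν := by
    obtain ⟨μ, hμ, hμρ⟩ := hρ
    exact ((hsν.properPrefix hμ).trans_isPrefix hμρ).2.symm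
  have hagree (ρ : List α) (hρ : ρ ∈ ucl s.pos) :
      p.AgreesAt T (Function.update p.cr ν s) ρ :=
    ⟨⟨fun h => hrepl.subset h, fun h => .inr ⟨h, hρ⟩⟩,
      fun _ => Function.update_of_ne (hne hρ) _ _⟩
  have hnorm : NormCond T (fun ρ => Function.update p.cr ν s ρ) e := by
    refine normCond_of_agreesAt (C := C) (fun x hx => ?_) ?_
    · obtain ⟨m, hm, hmT⟩ := hx ν.length
      refine ⟨p, m, fun k hk => hagree _ ?_⟩
      have hmA := (hmT.resolve_left fun h => hm.ne (by simp [← h])).2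
      exact mem_ucl_of_isPrefix hmA (initSeg_prefix_of_le x hk)
    · rintro ρ (rfl | hρ)
      · obtain ⟨μ, hμ⟩ := s.pos_nonempty
        exact ⟨p, μ, .inr ⟨pos_subset_of_mem_gens hs hμ, subset_ucl hμ⟩,
          (hsν.properPrefix hμ).1, fun π hπ => hagree π ⟨μ, hμ, hπ⟩⟩
      · exact ⟨p, ρ, .inr hρ, List.prefix_rfl, fun π hπ => hagree π (mem_ucl_of_isPrefix hρ.2 hπ)⟩
  obtain ⟨q, hpq, hqT, hqcr⟩ := hrepl.exists_condition hnorm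
  have hνq : ν ∈ q.T := hqT ▸ Set.mem_insert _ _
  refine ⟨q, hpq, ⟨hνq, fun ρ hρ => ?_⟩, ?_, fun μ hμ => ?_⟩
  · obtain rfl | ⟨-, π, hπ, hπρ⟩ := hqT ▸ hρ
    exacts [List.prefix_rfl, (hsν.properPrefix hπ).1.trans hπρ]
  · rw [hqcr ν (hqT ▸ hνq), Function.update_self]
  · have hμp := pos_subset_of_mem_gens hs hμ
    refine ⟨hqT ▸ .inr ⟨hμp, subset_ucl hμ⟩, hμp, ext_cr (Set.ext fun ρ => ?_) fun ρ hρ => ?_⟩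
    · exact and_congr_left fun hμρ => hqT ▸ (hagree ρ ⟨μ, hμ, hμρ⟩).1
    · have hρT : ρ ∈ T := hqT ▸ hρ.1
      rw [cr_restr hρ, cr_restr ⟨T_subset hpq hρ.1, hρ.2⟩, hqcr ρ hρT]
      exact (hagree ρ ⟨μ, hμ, hρ.2⟩).2 hρT

theorem exists_amalgamation (hs : s ∈ p.gens) (hsν : s.IsTreeCreatureAt ν)
    (hroot : ∀ μ ∈ s.pos, IsRoot (f μ).T μ) (hle : ∀ μ ∈ s.pos, p ≤ f μ) :
    ∃ q, p ≤ q ∧ IsRoot q.T ν ∧ q.cr ν = s ∧ ∀ μ ∈ s.pos, ∃ h, q.restr μ h = f μ := by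
  obtain ⟨q₀, hpq₀, hν, hcr, hrestr⟩ := exists_replaceRoot hs hsν
  have hle₀ (μ : List α) (hμ : μ ∈ s.pos) : q₀ ≤ f μ := by
    obtain ⟨h, h', heq⟩ := hrestr μ hμ
    exact (le_restr h).trans (heq ▸ restr_le (hle μ hμ) h' (hroot μ hμ).2)
  obtain ⟨q, hq₀q, hkeep, hglue⟩ := exists_glue (fun μ hμ => (hrestr μ hμ).1) hsν.2 hroot hle₀
  have hνA : ν ∉ ucl s.pos := fun ⟨_, hμ, hμν⟩ => (hsν.properPrefix hμ).not_isPrefix hμν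
  have ⟨hνq, hνcr⟩ := hkeep ν hν.1 hνA
  exact ⟨q, hpq₀.trans hq₀q, isRoot_of_le hν hq₀q hνq, hνcr.trans hcr, hglue⟩

/-- The nodes reached from `ν` by passing to possibilities of the creatures `σ`. -/
def reach (σ : List α → WeakCreature H D) (ν : List α) : Set (List α) :=
  {ρ | Relation.ReflTransGen (fun ρ μ => μ ∈ (σ ρ).pos) ν ρ}

theorem reach_subset (hν : ν ∈ S) (hS : ∀ ρ ∈ S, (σ ρ).pos ⊆ S) : reach σ ν ⊆ S := by
  intro ρ hρ
  induction hρ with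
  | refl => exact hν
  | tail _ hμ ih => exact hS _ ih hμ

theorem isPrefix_of_mem_reach (hσ : ∀ ρ ∈ reach σ ν, (σ ρ).IsTreeCreatureAt ρ)
    (h : ρ ∈ reach σ ν) : ν <+: ρ := by
  induction h with
  | refl => exact List.prefix_rfl
  | tail h hμ ih => exact ih.trans ((hσ _ h).properPrefix hμ).1

theorem exists_pos_isPrefix_of_mem_reach (hσ : ∀ ρ ∈ reach σ ν, (σ ρ).IsTreeCreatureAt ρ)
    {ρ π : List α} (hρ : ρ ∈ reach σ ν) (hπ : π ∈ reach σ ν) (hρπ : ProperPrefix ρ π) :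
    ∃ μ ∈ (σ ρ).pos, μ <+: π := by
  induction hn : ρ.length + π.length using Nat.strong_induction_on generalizing ρ π with
  | _ n ih =>
    cases hπ with
    | refl => exact (hρπ.not_isPrefix (isPrefix_of_mem_reach hσ hρ)).elim
    | @tail κ _ hκ hπκ =>
      have hκπ := (hσ κ hκ).properPrefix hπκ
      rcases isPrefix_or_properPrefix hρπ.1 hκπ.1 with h | h
      · by_cases heq : ρ = κ
        · exact ⟨π, heq ▸ hπκ, List.prefix_rfl⟩
        · obtain ⟨μ, hμ, hμκ⟩ := ih _ (by have := hκπ.length_lt; omega) hρ hκ ⟨h, heq⟩ rfl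
          exact ⟨μ, hμ, hμκ.trans hκπ.1⟩
      · obtain ⟨μ, hμ, hμρ⟩ := ih _ (by have := hκπ.length_lt; omega) hκ hρ h rfl
        exact ((hσ κ hκ).2 μ hμ π hπκ (.of_isPrefix hμρ hρπ)).elim

theorem isReplacement_reach (hSp : S ⊆ p.T) (hν : ν ∈ S) (hgens : ∀ ρ ∈ S, σ ρ ∈ p.gens)
    (hσ : ∀ ρ ∈ S, (σ ρ).IsTreeCreatureAt ρ) (hpos : ∀ ρ ∈ S, (σ ρ).pos ⊆ S) :
    p.IsReplacement (reach σ ν) σ := by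
  have hsub := reach_subset hν hpos
  have hσ' : ∀ ρ ∈ reach σ ν, (σ ρ).IsTreeCreatureAt ρ := fun ρ hρ => hσ ρ (hsub hρ)
  exact ⟨hsub.trans hSp, ⟨ν, .refl, fun ρ hρ => isPrefix_of_mem_reach hσ' hρ⟩,
    fun ρ hρ => hgens ρ (hsub hρ), hσ', fun ρ hρ μ hμ => .tail hρ hμ,
    fun ρ hρ π hπ h => exists_pos_isPrefix_of_mem_reach hσ' hρ hπ h⟩

theorem exists_prune {p : QTree C 1} (hSp : S ⊆ p.T) (hν : ν ∈ S)
    (hgens : ∀ ρ ∈ S, σ ρ ∈ p.gens) (hσ : ∀ ρ ∈ S, (σ ρ).IsTreeCreatureAt ρ)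
    (hpos : ∀ ρ ∈ S, (σ ρ).pos ⊆ S) (hnor : ∀ ρ ∈ S, (p.cr ρ).nor - 1 ≤ (σ ρ).nor) :
    ∃ q, p ≤ q ∧ q.T ⊆ S := by
  have hrepl := isReplacement_reach hSp hν hgens hσ hpos
  have hsub := reach_subset hν hpos
  have hnorm : NormCond (reach σ ν) (fun ρ => σ ρ) 1 := by
    intro x hx M
    obtain ⟨m, hm⟩ := p.normCond_cr x (lim_mono hrepl.subset hx) (M + 1)
    refine ⟨m, fun k hk hkT => (lt_sub_iff_add_lt.2 ?_).trans_le (hnor _ (hsub hkT))⟩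
    exact hm k hk (hrepl.subset hkT)
  obtain ⟨q, hpq, hqT, -⟩ := hrepl.exists_condition hnorm
  exact ⟨q, hpq, hqT ▸ hsub⟩

end Constructions

section Fusion

variable {𝓑 : QTree C e → Set (Set (List α))} {𝒩 𝒮 : Set (QTree C e)} {M : ℝ} {n : ℕ}

/-- The families `𝓑` of sets of nodes that the antichains of a fusion are required to meet. The two
instances are the trees of stronger conditions, which lead to thick antichains, and the branches,
which lead to fronts. -/
structure IsTestFamily (𝓑 : QTree C e → Set (Set (List α))) : Prop where
  subset : ∀ p, ∀ B ∈ 𝓑 p, B ⊆ p.T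
  nonempty : ∀ p, ∀ B ∈ 𝓑 p, B.Nonempty
  antitone : Antitone 𝓑
  restr : ∀ p, ∀ B ∈ 𝓑 p, ∀ ν ∈ dcl B, ∀ h : ν ∈ p.T,
    ∃ B' ∈ 𝓑 (p.restr ν h), B' ⊆ B ∧ ∀ μ ∈ B', ProperPrefix ν μ
  cone : e = 2 ∨ e = 3 → ∀ (p : QTree C e) (η : List α) (h : η ∈ p.T), (p.restr η h).T ∈ 𝓑 p

/-- `A` is an antichain of nodes of `p` which meets each test in `𝓑 p`. -/
structure IsBar (𝓑 : QTree C e → Set (Set (List α))) (p : QTree C e) (A : Set (List α)) :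
    Prop where
  subset : A ⊆ p.T
  antichain : IsPrefixAntichain A
  meets : ∀ B ∈ 𝓑 p, (A ∩ dcl B).Nonempty

theorem isBar_root (h𝓑 : IsTestFamily 𝓑) (hν : IsRoot p.T ν) : IsBar 𝓑 p {ν} := by
  refine ⟨Set.singleton_subset_iff.2 hν.1, isPrefixAntichain_singleton ν, fun B hB => ?_⟩
  obtain ⟨μ, hμ⟩ := h𝓑.nonempty p B hB
  exact ⟨ν, rfl, μ, hμ, hν.2 μ (h𝓑.subset p B hB hμ)⟩

/-- The norms of `q`, a condition stronger than `p`, are at least `M` as far as this is needed to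
obtain the norm condition for the limit of a fusion. -/
structure IsLarge (M : ℝ) (p q : QTree C e) : Prop where
  root : e = 0 ∨ e = 2 → ∀ ν, IsRoot q.T ν → M ≤ (q.cr ν).nor
  new : e = 1 → ∀ ν ∈ q.T, q.cr ν = p.cr ν ∨ M ≤ (q.cr ν).nor
  all : e = 3 → ∀ ν ∈ q.T, M ≤ (q.cr ν).nor

theorem IsLarge.of_restr {hν : ν ∈ p.T} (hle : p.restr ν hν ≤ q)
    (hq : IsLarge M (p.restr ν hν) q) : IsLarge M p q :=
  ⟨hq.root, fun he ρ hρ => cr_restr (T_subset hle hρ) ▸ hq.new he ρ hρ, hq.all⟩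

/-- Each condition in `𝒩` has, along each test, a stronger condition in `𝒮` with large norms. -/
def IsDenseAlong (𝓑 : QTree C e → Set (Set (List α))) (M : ℝ) (𝒩 𝒮 : Set (QTree C e)) : Prop :=
  ∀ p ∈ 𝒩, ∀ B ∈ 𝓑 p, ∃ μ ∈ B, ∃ q ∈ 𝒮, IsRoot q.T μ ∧ p ≤ q ∧ IsLarge M p q

/-- A single step of a fusion: `q` results from `p` by changes above the elements of `A'` only,
which lie above those of `A`. -/
structure IsFusionStep (𝓑 : QTree C e → Set (Set (List α))) (𝒮 : Set (QTree C e)) (M : ℝ)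
    (p : QTree C e) (A : Set (List α)) (q : QTree C e) (A' : Set (List α)) : Prop where
  le : p ≤ q
  bar : IsBar 𝓑 q A'
  keep : ∀ ν ∈ p.T, ν ∉ ucl A' → ν ∈ q.T ∧ q.cr ν = p.cr ν
  above : ∀ μ ∈ A', ∃ ν ∈ A, ProperPrefix ν μ
  cone : ∀ μ ∈ A', ∃ h, q.restr μ h ∈ 𝒮 ∧ IsLarge M p (q.restr μ h)

theorem exists_fusionStep (h𝓑 : IsTestFamily 𝓑) (hd : IsDenseAlong 𝓑 M 𝒩 𝒮) (hA : IsBar 𝓑 p A)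
    (hA𝒩 : ∀ ν ∈ A, ∃ h, p.restr ν h ∈ 𝒩) : ∃ q A', IsFusionStep 𝓑 𝒮 M p A q A' := by
  let Z : Set (List α) := {μ | ∃ ν ∈ A, ProperPrefix ν μ ∧ ∃ h : ν ∈ p.T, ∃ q ∈ 𝒮,
    IsRoot q.T μ ∧ p.restr ν h ≤ q ∧ IsLarge M (p.restr ν h) q}
  have hZ : ∀ μ ∈ minPts Z, ∃ q ∈ 𝒮, IsRoot q.T μ ∧ p ≤ q ∧ (∃ ν ∈ A, ProperPrefix ν μ) ∧
      IsLarge M p q := by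
    rintro μ ⟨⟨ν, hν, hνμ, h, q, hq, hμ, hle, hlarge⟩, -⟩
    exact ⟨q, hq, hμ, (le_restr h).trans hle, ⟨ν, hν, hνμ⟩, hlarge.of_restr hle⟩
  have : Nonempty (QTree C e) := ⟨p⟩
  choose! f hf𝒮 hroot hle habove hlarge using hZ
  have hZp : minPts Z ⊆ p.T := fun μ hμ => T_subset (hle μ hμ) (hroot μ hμ).1
  have hanti := isPrefixAntichain_minPts Z
  obtain ⟨q, hpq, hkeep, hglue⟩ := exists_glue hZp hanti hroot hle
  refine ⟨q, minPts Z, hpq, ⟨fun μ hμ => (hglue μ hμ).1, hanti, fun B hB => ?_⟩, hkeep, habove,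
    fun μ hμ => ?_⟩
  · have hBp := h𝓑.antitone hpq hB
    obtain ⟨ν, hν, hνB⟩ := hA.meets B hBp
    obtain ⟨h, hν𝒩⟩ := hA𝒩 ν hν
    obtain ⟨B', hB', hB'B, hνB'⟩ := h𝓑.restr p B hBp ν hνB h
    obtain ⟨μ, hμ, s, hs⟩ := hd _ hν𝒩 B' hB'
    obtain ⟨ρ, hρ, hρμ⟩ := subset_ucl_minPts Z ⟨ν, hν, hνB' μ hμ, h, s, hs⟩
    exact ⟨ρ, hρ, μ, hB'B hμ, hρμ⟩
  · obtain ⟨h, heq⟩ := hglue μ hμ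
    exact ⟨h, heq ▸ hf𝒮 μ hμ, heq ▸ hlarge μ hμ⟩

/-- A sequence of fusion steps, the `k`-th one of which makes the new norms at least `k + n`. -/
structure IsFusion (𝓑 : QTree C e → Set (Set (List α))) (𝒮 : ℕ → Set (QTree C e)) (n : ℕ)
    (p : ℕ → QTree C e) (A : ℕ → Set (List α)) : Prop where
  bar_zero : IsBar 𝓑 (p 0) (A 0)
  step : ∀ k, IsFusionStep 𝓑 (𝒮 k) (k + n : ℕ) (p k) (A k) (p (k + 1)) (A (k + 1))

theorem exists_isFusion {𝒮 : ℕ → Set (QTree C e)} (h𝓑 : IsTestFamily 𝓑)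
    (hd : ∀ k, IsDenseAlong 𝓑 (k + n : ℕ) 𝒩 (𝒮 k)) (h𝒮 : ∀ k, 𝒮 k ⊆ 𝒩) (hA : IsBar 𝓑 p A)
    (hA𝒩 : ∀ ν ∈ A, ∃ h, p.restr ν h ∈ 𝒩) :
    ∃ (f : ℕ → QTree C e) (F : ℕ → Set (List α)), f 0 = p ∧ F 0 = A ∧ IsFusion 𝓑 𝒮 n f F := by
  let State := {s : QTree C e × Set (List α) //
    IsBar 𝓑 s.1 s.2 ∧ ∀ ν ∈ s.2, ∃ h, s.1.restr ν h ∈ 𝒩}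
  have exists_next (k : ℕ) (s : State) :
      ∃ s' : State, IsFusionStep 𝓑 (𝒮 k) (k + n : ℕ) s.1.1 s.1.2 s'.1.1 s'.1.2 := by
    obtain ⟨q, A', h⟩ := exists_fusionStep h𝓑 (hd k) s.2.1 s.2.2
    exact ⟨⟨(q, A'), h.bar, fun μ hμ => (h.cone μ hμ).imp fun _ hq => h𝒮 k hq.1⟩, h⟩
  choose next hnext using exists_next
  let s (k : ℕ) : State := Nat.rec ⟨(p, A), hA, hA𝒩⟩ next k
  exact ⟨fun k => (s k).1.1, fun k => (s k).1.2, rfl, rfl, hA, fun k => hnext k (s k)⟩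

namespace IsFusion

variable {𝒮 : ℕ → Set (QTree C e)} {p : ℕ → QTree C e} {A : ℕ → Set (List α)} {j k : ℕ}
  {c : List α → WeakCreature H D}

/-- The nodes at which the conditions of a fusion do not change any more from `p k` on. -/
def settled (p : ℕ → QTree C e) (A : ℕ → Set (List α)) (k : ℕ) : Set (List α) :=
  (p k).T \ ucl (A (k + 1))

theorem monotone (h : IsFusion 𝓑 𝒮 n p A) : Monotone p :=
  monotone_nat_of_le_succ fun k => (h.step k).le

theorem bar (h : IsFusion 𝓑 𝒮 n p A) : ∀ k, IsBar 𝓑 (p k) (A k)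
  | 0 => h.bar_zero
  | k + 1 => (h.step k).bar

theorem le_length (h : IsFusion 𝓑 𝒮 n p A) (hη : η ∈ A k) : k ≤ η.length := by
  induction k generalizing η with
  | zero => exact Nat.zero_le _
  | succ k ih =>
    obtain ⟨ν, hν, hνη⟩ := (h.step k).above η hη
    exact (ih hν).trans_lt hνη.length_lt

theorem mem_settled_of_le (h : IsFusion 𝓑 𝒮 n p A) (hjk : j ≤ k) (hν : ν ∈ settled p A j) :
    ν ∈ settled p A k ∧ (p k).cr ν = (p j).cr ν := by
  induction k, hjk using Nat.le_induction with
  | base => exact ⟨hν, rfl⟩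
  | succ k _ ih =>
    have ⟨hνp, hcr⟩ := (h.step k).keep ν ih.1.1 ih.1.2
    refine ⟨⟨hνp, fun ⟨η, hη, hην⟩ => ih.1.2 ?_⟩, hcr.trans ih.2⟩
    obtain ⟨ρ, hρ, hρη⟩ := (h.step (k + 1)).above η hη
    exact ⟨ρ, hρ, hρη.1.trans hην⟩

theorem mem_settled_of_not_properPrefix (h : IsFusion 𝓑 𝒮 n p A) (hν : ν ∈ (p k).T)
    (hA : ∀ η ∈ A k, ¬ ProperPrefix η ν) : ν ∈ settled p A k := by
  refine ⟨hν, fun ⟨η, hη, hην⟩ => ?_⟩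
  obtain ⟨ρ, hρ, hρη⟩ := (h.step k).above η hη
  exact hA ρ hρ (hρη.trans_isPrefix hην)

theorem subset_settled (h : IsFusion 𝓑 𝒮 n p A) (k : ℕ) : A k ⊆ settled p A k := fun ν hν =>
  h.mem_settled_of_not_properPrefix ((h.bar k).subset hν) fun η hη =>
    (h.bar k).antichain η hη ν hν

theorem pos_subset_settled (h : IsFusion 𝓑 𝒮 n p A) (hν : ν ∈ settled p A k) :
    ((p k).cr ν).pos ⊆ settled p A (k + 1) := by
  have ⟨hνs, hcr⟩ := h.mem_settled_of_le k.le_succ hν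
  rw [← hcr, pos_cr hνs.1]
  refine fun μ ⟨hμ, hνμ, himm⟩ => h.mem_settled_of_not_properPrefix hμ fun η hη hημ => himm ?_
  have hνη := (isPrefix_or_properPrefix hημ.1 hνμ.1).resolve_left fun hην => hν.2 ⟨η, hη, hην⟩
  exact ⟨η, (h.bar _).subset hη, hνη, hημ⟩

theorem cr_eq_or_le_nor (h : IsFusion 𝓑 𝒮 n p A) (he : e = 1) (hjk : j ≤ k) (hν : ν ∈ (p k).T) :
    (p k).cr ν = (p j).cr ν ∨ ((j + n : ℕ) : ℝ) ≤ ((p k).cr ν).nor := by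
  induction k, hjk using Nat.le_induction with
  | base => exact .inl rfl
  | succ k hjk ih =>
    have hνp := T_subset (h.step k).le hν
    have hstep : (p (k + 1)).cr ν = (p k).cr ν ∨ ((k + n : ℕ) : ℝ) ≤ ((p (k + 1)).cr ν).nor := by
      by_cases hνA : ν ∈ ucl (A (k + 1))
      · obtain ⟨η, hη, hην⟩ := hνA
        obtain ⟨hηp, -, hlarge⟩ := (h.step k).cone η hη
        have hνη : ν ∈ ((p (k + 1)).restr η hηp).T := ⟨hν, hην⟩
        exact cr_restr hνη ▸ hlarge.new he ν hνη
      · exact .inl ((h.step k).keep ν hνp hνA).2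
    obtain heq | hle := hstep
    · exact heq ▸ ih hνp
    · exact .inr (le_trans (by gcongr) hle)

theorem le_nor_of_mem (h : IsFusion 𝓑 𝒮 n p A) (he : e = 0 ∨ e = 2) (hη : η ∈ A (k + 1)) :
    ((k + n : ℕ) : ℝ) ≤ ((p (k + 1)).cr η).nor := by
  obtain ⟨hηp, -, hlarge⟩ := (h.step k).cone η hη
  exact cr_restr (isRoot_restr hηp).1 ▸ hlarge.root he η (isRoot_restr hηp)

theorem le_nor_of_isPrefix (h : IsFusion 𝓑 𝒮 n p A) (he : e = 3) (hη : η ∈ A (j + 1))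
    (hην : η <+: ν) (hjk : j + 1 ≤ k) (hν : ν ∈ (p k).T) :
    ((j + n : ℕ) : ℝ) ≤ ((p k).cr ν).nor := by
  have of_mem_ucl {k : ℕ} (hν : ν ∈ (p (k + 1)).T) (hνA : ν ∈ ucl (A (k + 1))) :
      ((k + n : ℕ) : ℝ) ≤ ((p (k + 1)).cr ν).nor := by
    obtain ⟨η, hη, hην⟩ := hνA
    obtain ⟨hηp, -, hlarge⟩ := (h.step k).cone η hη
    have hνη : ν ∈ ((p (k + 1)).restr η hηp).T := ⟨hν, hην⟩
    exact cr_restr hνη ▸ hlarge.all he ν hνη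
  induction k, hjk using Nat.le_induction with
  | base => exact of_mem_ucl hν ⟨η, hη, hην⟩
  | succ k hjk ih =>
    by_cases hνA : ν ∈ ucl (A (k + 1))
    · exact le_trans (by gcongr; omega) (of_mem_ucl hν hνA)
    · have hνp := T_subset (h.step k).le hν
      exact ((h.step k).keep ν hνp hνA).2 ▸ ih hνp

theorem exists_le_mem_settled (h : IsFusion 𝓑 𝒮 n p A) (k : ℕ) (hν : ν ∈ ⋃ k, settled p A k) :
    ∃ j, k ≤ j ∧ ν ∈ settled p A j := by
  obtain ⟨j, hj⟩ := Set.mem_iUnion.1 hν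
  exact ⟨max k j, le_max_left k j, (h.mem_settled_of_le (le_max_right k j) hj).1⟩

theorem iUnion_settled_subset (h : IsFusion 𝓑 𝒮 n p A) (k : ℕ) :
    ⋃ j, settled p A j ⊆ (p k).T := fun _ hν =>
  have ⟨_, hkj, hνj⟩ := h.exists_le_mem_settled k hν
  T_subset (h.monotone hkj) hνj.1

theorem exists_limit_cr (h : IsFusion 𝓑 𝒮 n p A) :
    ∃ c : List α → WeakCreature H D, ∀ k, ∀ ν ∈ settled p A k, c ν = (p k).cr ν := by
  have exists_cr (ν : List α) :
      ∃ w : WeakCreature H D, ∀ k, ν ∈ settled p A k → w = (p k).cr ν := by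
    by_cases hν : ∃ j, ν ∈ settled p A j
    · obtain ⟨j, hj⟩ := hν
      refine ⟨(p j).cr ν, fun k hk => ?_⟩
      obtain hjk | hkj := le_total j k
      exacts [(h.mem_settled_of_le hjk hj).2.symm, (h.mem_settled_of_le hkj hk).2]
    · exact ⟨(p 0).cr ν, fun k hk => (hν ⟨k, hk⟩).elim⟩
  choose c hc using exists_cr
  exact ⟨c, fun k ν => hc ν k⟩

theorem isReplacement_limit (h : IsFusion 𝓑 𝒮 n p A)
    (hc : ∀ k, ∀ ν ∈ settled p A k, c ν = (p k).cr ν) (k : ℕ) :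
    (p k).IsReplacement (⋃ j, settled p A j) c := by
  have hsub := h.iUnion_settled_subset k
  refine ⟨hsub, ?_, fun ν hν => ?_, fun ν hν => ?_, fun ν hν => ?_, fun ν hν ρ hρ hνρ => ?_⟩
  · obtain ⟨r, hr⟩ := (p 0).quasi
    refine ⟨r, Set.mem_iUnion.2 ⟨0, h.mem_settled_of_not_properPrefix hr.1 fun η hη hηr => ?_⟩,
      fun ν hν => hr.2 ν (h.iUnion_settled_subset 0 hν)⟩
    exact hηr.not_isPrefix (hr.2 η ((h.bar 0).subset hη))
  all_goals obtain ⟨j, hkj, hνj⟩ := h.exists_le_mem_settled k hν; rw [hc j ν hνj]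
  · exact cr_mem_gens_of_le (h.monotone hkj) hνj.1
  · exact cr_creature hνj.1
  · exact (h.pos_subset_settled hνj).trans (Set.subset_iUnion _ _)
  · exact exists_pos_cr_isPrefix hνj.1 (h.iUnion_settled_subset j hρ) hνρ

theorem exists_bar_properPrefix (h : IsFusion 𝓑 𝒮 n p A) (h𝓑 : IsTestFamily 𝓑)
    (he : e = 2 ∨ e = 3) (k : ℕ) (hν : ν ∈ ⋃ k, settled p A k) :
    ∃ j, k ≤ j ∧ ∃ η ∈ A (j + 1), ProperPrefix ν η := by
  obtain ⟨j, hkj, hνj⟩ := h.exists_le_mem_settled k hν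
  obtain ⟨η, hη, ρ, hρ, hηρ⟩ := (h.bar (j + 1)).meets _
    (h𝓑.cone he (p (j + 1)) ν (h.iUnion_settled_subset _ hν))
  exact ⟨j, hkj, η, hη,
    (isPrefix_or_properPrefix hηρ hρ.2).resolve_left fun hην => hνj.2 ⟨η, hη, hην⟩⟩

theorem normCond_limit_zero {𝓑 : QTree C 0 → Set (Set (List α))} {𝒮 : ℕ → Set (QTree C 0)}
    {p : ℕ → QTree C 0} (h : IsFusion 𝓑 𝒮 n p A)
    (hc : ∀ k, ∀ ν ∈ settled p A k, c ν = (p k).cr ν) :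
    NormCond (⋃ k, settled p A k) (fun ν => c ν) 0 := by
  intro x hx M m
  obtain ⟨N, hN⟩ := exists_nat_gt M
  set k := max m N
  by_cases hxA : ∃ i, initSeg x i ∈ A (k + 1)
  · obtain ⟨i, hi⟩ := hxA
    have his := h.subset_settled (k + 1) hi
    have hki : k + 1 ≤ i := length_initSeg x i ▸ h.le_length hi
    refine ⟨i, by omega, Set.mem_iUnion.2 ⟨_, his⟩, hN.trans_le ?_⟩
    simp only [hc _ _ his]
    exact le_trans (by gcongr; omega) (h.le_nor_of_mem (.inl rfl) hi)
  · obtain ⟨i, hi, hip, hM⟩ := (p k).normCond_cr x (lim_mono (h.iUnion_settled_subset k) hx) M m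
    have his : initSeg x i ∈ settled p A k :=
      ⟨hip, fun ⟨η, hη, hηi⟩ => hxA ⟨η.length, eq_initSeg_of_isPrefix hηi ▸ hη⟩⟩
    exact ⟨i, hi, Set.mem_iUnion.2 ⟨k, his⟩, hM.trans_eq (congrArg _ (hc k _ his).symm)⟩

theorem normCond_limit_one {𝓑 : QTree C 1 → Set (Set (List α))} {𝒮 : ℕ → Set (QTree C 1)}
    {p : ℕ → QTree C 1} (h : IsFusion 𝓑 𝒮 n p A)
    (hc : ∀ k, ∀ ν ∈ settled p A k, c ν = (p k).cr ν) :
    NormCond (⋃ k, settled p A k) (fun ν => c ν) 1 := by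
  intro x hx M
  obtain ⟨k, hk⟩ := exists_nat_gt M
  obtain ⟨m, hm⟩ := (p k).normCond_cr x (lim_mono (h.iUnion_settled_subset k) hx) M
  refine ⟨m, fun i hi hiT => ?_⟩
  obtain ⟨j, hkj, hij⟩ := h.exists_le_mem_settled k hiT
  simp only [hc j _ hij]
  obtain heq | hle := h.cr_eq_or_le_nor rfl hkj hij.1
  · exact heq ▸ hm i hi (h.iUnion_settled_subset k hiT)
  · exact hk.trans_le (le_trans (by gcongr; omega) hle)

theorem normCond_limit_two {𝓑 : QTree C 2 → Set (Set (List α))} {𝒮 : ℕ → Set (QTree C 2)}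
    {p : ℕ → QTree C 2} (h : IsFusion 𝓑 𝒮 n p A) (h𝓑 : IsTestFamily 𝓑)
    (hc : ∀ k, ∀ ν ∈ settled p A k, c ν = (p k).cr ν) :
    NormCond (⋃ k, settled p A k) (fun ν => c ν) 2 := by
  intro ν hν N
  obtain ⟨j, hNj, η, hη, hνη⟩ := h.exists_bar_properPrefix h𝓑 (.inl rfl) N hν
  have hηs := h.subset_settled (j + 1) hη
  refine ⟨⟨η, Set.mem_iUnion.2 ⟨_, hηs⟩⟩, hνη, ?_⟩
  simp only [hc _ _ hηs]
  exact le_trans (by gcongr; omega) (h.le_nor_of_mem (.inr rfl) hη)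

theorem normCond_limit_three {𝓑 : QTree C 3 → Set (Set (List α))} {𝒮 : ℕ → Set (QTree C 3)}
    {p : ℕ → QTree C 3} (h : IsFusion 𝓑 𝒮 n p A) (h𝓑 : IsTestFamily 𝓑)
    (hc : ∀ k, ∀ ν ∈ settled p A k, c ν = (p k).cr ν) :
    NormCond (⋃ k, settled p A k) (fun ν => c ν) 3 := by
  intro ν hν N
  obtain ⟨j, hNj, η, hη, hνη⟩ := h.exists_bar_properPrefix h𝓑 (.inr rfl) N hν
  refine ⟨η, Set.mem_iUnion.2 ⟨_, h.subset_settled (j + 1) hη⟩, hνη, fun ρ hηρ => ?_⟩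
  obtain ⟨i, hji, hρi⟩ := h.exists_le_mem_settled (j + 1) ρ.2
  simp only [hc _ _ hρi]
  exact le_trans (by gcongr; omega) (h.le_nor_of_isPrefix rfl hη hηρ.1 hji hρi.1)

theorem exists_limit (h : IsFusion 𝓑 𝒮 n p A) (h𝓑 : IsTestFamily 𝓑) :
    ∃ q : QTree C e, (∀ k, p k ≤ q) ∧ q.T = ⋃ k, settled p A k ∧
      ∀ k, ∀ ν ∈ settled p A k, q.cr ν = (p k).cr ν := by
  obtain ⟨c, hc⟩ := h.exists_limit_cr
  have hnorm : NormCond (⋃ k, settled p A k) (fun ν => c ν) e := by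
    fin_cases e
    exacts [h.normCond_limit_zero hc, h.normCond_limit_one hc, h.normCond_limit_two h𝓑 hc,
      h.normCond_limit_three h𝓑 hc]
  obtain ⟨q, -, hqT, hqc⟩ := (h.isReplacement_limit hc 0).exists_condition hnorm
  refine ⟨q, fun k => le_iff.2 ⟨hqT ▸ h.iUnion_settled_subset k, fun ν hν => ?_⟩, hqT,
    fun k ν hν => (hqc ν (Set.mem_iUnion.2 ⟨k, hν⟩)).trans (hc k ν hν)⟩
  rw [hqT] at hν
  exact hqc ν hν ▸ (h.isReplacement_limit hc k).mem_gens ν hν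

end IsFusion

theorem exists_fusion {𝒮 : ℕ → Set (QTree C e)} (h𝓑 : IsTestFamily 𝓑)
    (hd : ∀ k, IsDenseAlong 𝓑 (k + n : ℕ) 𝒩 (𝒮 k)) (h𝒮 : ∀ k, 𝒮 k ⊆ 𝒩) (hA : IsBar 𝓑 p A)
    (hA𝒩 : ∀ ν ∈ A, ∃ h, p.restr ν h ∈ 𝒩) :
    ∃ q, p ≤ q ∧ (∀ k, ∀ B ∈ 𝓑 q, ∃ μ ∈ B, ∃ h, ∃ s ∈ 𝒮 k, s ≤ q.restr μ h) ∧
      (∀ ν ∈ p.T, (∀ η ∈ A, ¬ ProperPrefix η ν) → ν ∈ q.T ∧ q.cr ν = p.cr ν) ∧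
      (e = 1 → ∀ ν ∈ q.T, q.cr ν = p.cr ν ∨ (n : ℝ) ≤ (q.cr ν).nor) := by
  obtain ⟨f, F, rfl, rfl, h⟩ := exists_isFusion h𝓑 hd h𝒮 hA hA𝒩
  obtain ⟨q, hle, hqT, hqcr⟩ := h.exists_limit h𝓑
  refine ⟨q, hle 0, fun k B hB => ?_, fun ν hν hνA => ?_, fun he ν hν => ?_⟩
  · obtain ⟨η, hη, μ, hμ, hημ⟩ := (h.bar (k + 1)).meets B (h𝓑.antitone (hle _) hB)
    obtain ⟨hηf, hη𝒮, -⟩ := (h.step k).cone η hη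
    have hμq := h𝓑.subset q B hB hμ
    exact ⟨μ, hμ, hμq, _, hη𝒮, restr_le_restr (hle _) hηf hμq hημ⟩
  · have hνs := h.mem_settled_of_not_properPrefix hν hνA
    exact ⟨hqT ▸ Set.mem_iUnion.2 ⟨0, hνs⟩, hqcr 0 ν hνs⟩
  · obtain ⟨k, hk⟩ := Set.mem_iUnion.1 (hqT ▸ hν)
    rw [hqcr k ν hk]
    simpa only [Nat.zero_add] using h.cr_eq_or_le_nor he k.zero_le hk.1

theorem IsBar.exists_above {Y : Set (List α)} (h𝓑 : IsTestFamily 𝓑) (hA : IsBar 𝓑 p A)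
    (hYp : Y ⊆ p.T) (hY : ∀ B ∈ 𝓑 p, (B ∩ Y).Nonempty) :
    ∃ A' ⊆ Y, IsBar 𝓑 p A' ∧ ∀ μ ∈ A', ∃ ν ∈ A, ProperPrefix ν μ := by
  let Z : Set (List α) := {μ ∈ Y | ∃ ν ∈ A, ProperPrefix ν μ}
  refine ⟨minPts Z, fun μ hμ => hμ.1.1, ⟨fun μ hμ => hYp hμ.1.1, isPrefixAntichain_minPts Z,
    fun B hB => ?_⟩, fun μ hμ => hμ.1.2⟩
  obtain ⟨ν, hν, hνB⟩ := hA.meets B hB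
  obtain ⟨B', hB', hB'B, hνB'⟩ := h𝓑.restr p B hB ν hνB (hA.subset hν)
  obtain ⟨μ, hμ, hμY⟩ := hY B' (h𝓑.antitone (le_restr _) hB')
  obtain ⟨ρ, hρ, hρμ⟩ := subset_ucl_minPts Z ⟨hμY, ν, hν, hνB' μ hμ⟩
  exact ⟨ρ, hρ, μ, hB'B hμ, hρμ⟩

theorem exists_isBar_sequence {Y : ℕ → Set (List α)} (h𝓑 : IsTestFamily 𝓑)
    (hYp : ∀ k, Y k ⊆ p.T) (hY : ∀ k, ∀ B ∈ 𝓑 p, (B ∩ Y k).Nonempty) :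
    ∃ F : ℕ → Set (List α), (∀ k, IsBar 𝓑 p (F k)) ∧ (∀ k, F k ⊆ Y k) ∧
      ∀ k, ∀ μ ∈ F (k + 1), ∃ ν ∈ F k, ProperPrefix ν μ := by
  obtain ⟨r, hr⟩ := p.quasi
  choose next hnextY hnext hnext_above using
    fun (k : ℕ) (A : {A // IsBar 𝓑 p A}) => A.2.exists_above h𝓑 (hYp k) (hY k)
  let F (k : ℕ) : {A // IsBar 𝓑 p A} :=
    Nat.rec ⟨{r}, isBar_root h𝓑 hr⟩ (fun k A => ⟨next k A, hnext k A⟩) k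
  exact ⟨fun k => F (k + 1), fun k => (F (k + 1)).2, fun k => hnextY k (F k),
    fun k => hnext_above (k + 1) (F (k + 1))⟩

end Fusion

section LargeNorms

theorem exists_initSeg_lt_nor (he : e = 0 ∨ e = 1) {x : ℕ → α} (hx : x ∈ lim p.T) (M : ℝ) :
    ∃ k, initSeg x k ∈ p.T ∧ M < (p.cr (initSeg x k)).nor := by
  have hp := p.normCond_cr
  obtain rfl | rfl := he
  · obtain ⟨k, -, hk, hM⟩ := hp x hx M 0
    exact ⟨k, hk, hM⟩
  · obtain ⟨m, hm⟩ := hp x hx M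
    obtain ⟨k, hk, hkT⟩ := hx m
    exact ⟨k, hkT, hm k hk.le hkT⟩

theorem exists_forall_le_nor {p : QTree C 1} {S : Set (List α)} (hSp : S ⊆ p.T)
    (hS : S.Nonempty) (M : ℝ) : ∃ ν ∈ S, ∀ ρ ∈ S, ProperPrefix ν ρ → M ≤ (p.cr ρ).nor := by
  by_contra! hsmall
  obtain ⟨ν, hν⟩ := hS
  obtain ⟨η, hη, -, hηM⟩ := hsmall ν hν
  obtain ⟨x, hx, -⟩ := exists_branch_of_forall_exists_properPrefix
    (S := {ρ ∈ S | (p.cr ρ).nor < M}) ⟨hη, hηM⟩ fun ρ hρ =>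
      have ⟨μ, hμ, hρμ, hM⟩ := hsmall ρ hρ.1
      ⟨μ, ⟨hμ, hM⟩, hρμ⟩
  obtain ⟨m, hm⟩ := p.normCond_cr x (lim_mono (fun ρ hρ => hSp hρ.1) hx) M
  obtain ⟨k, hk, hkS⟩ := hx m
  exact lt_asymm (hm k hk.le (hSp hkS.1)) hkS.2

theorem exists_le_nor (p : QTree C e) (M : ℝ) : ∃ ν ∈ p.T, M ≤ (p.cr ν).nor := by
  obtain ⟨r, hr⟩ := p.quasi
  obtain ⟨N, hN⟩ := exists_nat_ge M
  have of_branch (he : e = 0 ∨ e = 1) : ∃ ν ∈ p.T, M ≤ (p.cr ν).nor := by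
    obtain ⟨x, hx, -⟩ := exists_branch hr.1
    obtain ⟨k, hk, hM⟩ := exists_initSeg_lt_nor he hx M
    exact ⟨_, hk, hM.le⟩
  have hp := p.normCond_cr
  fin_cases e
  · exact of_branch (.inl rfl)
  · exact of_branch (.inr rfl)
  · obtain ⟨ν, -, hν⟩ := hp r hr.1 N
    exact ⟨ν, ν.2, hN.trans hν⟩
  · obtain ⟨ν, hν, -, hN'⟩ := hp r hr.1 N
    obtain ⟨μ, hμ, hνμ⟩ := exists_mem_properPrefix hν
    exact ⟨μ, hμ, hN.trans (hN' ⟨μ, hμ⟩ hνμ)⟩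

theorem exists_cone_le_nor (he : e = 1 ∨ e = 3) (p : QTree C e) (M : ℝ) :
    ∃ ν ∈ p.T, ∀ ρ ∈ p.T, ν <+: ρ → M ≤ (p.cr ρ).nor := by
  obtain ⟨r, hr⟩ := p.quasi
  have exists_strict_cone : ∃ ν ∈ p.T, ∀ ρ ∈ p.T, ProperPrefix ν ρ → M ≤ (p.cr ρ).nor := by
    obtain rfl | rfl := he
    · exact exists_forall_le_nor subset_rfl ⟨r, hr.1⟩ M
    · obtain ⟨N, hN⟩ := exists_nat_ge M
      obtain ⟨ν, hν, -, hN'⟩ := p.normCond_cr r hr.1 N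
      exact ⟨ν, hν, fun ρ hρ hνρ => hN.trans (hN' ⟨ρ, hρ⟩ hνρ)⟩
  obtain ⟨ν, hν, hM⟩ := exists_strict_cone
  obtain ⟨μ, hμ, hνμ⟩ := exists_mem_properPrefix hν
  exact ⟨μ, hμ, fun ρ hρ hμρ => hM ρ hρ (hνμ.trans_isPrefix hμρ)⟩

theorem exists_isLarge_restr (p : QTree C e) (M : ℝ) :
    ∃ ν, ∃ h : ν ∈ p.T, ∀ q : QTree C e, IsLarge M q (p.restr ν h) := by
  by_cases he : e = 1 ∨ e = 3
  · obtain ⟨ν, hν, hM⟩ := exists_cone_le_nor he p M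
    have hM' : ∀ ρ ∈ (p.restr ν hν).T, M ≤ ((p.restr ν hν).cr ρ).nor := fun ρ hρ =>
      cr_restr hρ ▸ hM ρ hρ.1 hρ.2
    exact ⟨ν, hν, fun q => ⟨fun _ ρ hρ => hM' ρ hρ.1, fun _ ρ hρ => .inr (hM' ρ hρ), fun _ => hM'⟩⟩
  · obtain ⟨ν, hν, hM⟩ := exists_le_nor p M
    refine ⟨ν, hν, fun q => ⟨fun _ ρ hρ => ?_, fun h => (he (.inl h)).elim,
      fun h => (he (.inr h)).elim⟩⟩
    rwa [cr_restr hρ.1, hρ.unique (isRoot_restr hν)]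

theorem exists_lt_nor_of_le (hC : 2 ≤ e → C.IsBounded) (hpq : p ≤ q) (M : ℝ) :
    ∃ ν ∈ p.T, ν ∈ dcl q.T ∧ M < (p.cr ν).nor := by
  by_cases he : 2 ≤ e
  · obtain ⟨ν, hν, hM⟩ := exists_le_nor q (M + 1)
    obtain ⟨T, hT, hs, hsig⟩ := exists_system_of_mem_gens (cr_mem_gens_of_le hpq hν)
    obtain ⟨ρ, η, hη, hρη, hρM⟩ : ∃ ρ : hat T, ∃ η ∈ (q.cr ν).pos, ProperPrefix ρ η ∧
        M < (p.cr ρ).nor := by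
      by_contra! hle
      have := hC he T _ hs (q.cr ν) (by rwa [← Set.image_eq_range]) M
        fun ρ ⟨η, hη, hρη⟩ => hle ρ η hη hρη
      linarith
    exact ⟨ρ, hT ρ.2.1, ⟨η, pos_cr_subset hν hη, hρη.1⟩, hρM⟩
  · obtain ⟨r, hr⟩ := q.quasi
    obtain ⟨x, hx, -⟩ := exists_branch hr.1
    obtain ⟨k, hk, hM⟩ := exists_initSeg_lt_nor (by revert he; fin_cases e <;> decide)
      (lim_mono (T_subset hpq) hx) M
    obtain ⟨i, hki, hi⟩ := hx k
    exact ⟨_, hk, ⟨_, hi, initSeg_prefix_of_le x hki.le⟩, hM⟩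

end LargeNorms

section Tests

/-- The trees of the conditions stronger than `p`. -/
def thickTests (p : QTree C e) : Set (Set (List α)) := {B | ∃ r, p ≤ r ∧ B = r.T}

/-- The infinite subsets of the branches of `p`. -/
def branchTests (p : QTree C e) : Set (Set (List α)) :=
  {B | B ⊆ p.T ∧ ∃ x ∈ lim B, ∀ ν ∈ B, ∃ k, ν = initSeg x k}

theorem isTestFamily_thickTests : IsTestFamily (thickTests (C := C) (e := e)) where
  subset := fun _ _ ⟨_, hr, hB⟩ => hB ▸ T_subset hr
  nonempty := fun _ _ ⟨r, _, hB⟩ => hB ▸ r.quasi.imp fun _ h => h.1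
  antitone := fun _ _ hpq _ ⟨r, hr, hB⟩ => ⟨r, hpq.trans hr, hB⟩
  restr := by
    rintro p _ ⟨r, hr, rfl⟩ ν ⟨μ, hμ, hνμ⟩ h
    obtain ⟨ρ, hρ, hμρ⟩ := exists_mem_properPrefix hμ
    have hνρ := hμρ.of_isPrefix hνμ
    exact ⟨_, ⟨r.restr ρ hρ, restr_le_restr hr h hρ hνρ.1, rfl⟩, fun σ hσ => hσ.1,
      fun σ hσ => hνρ.trans_isPrefix hσ.2⟩
  cone := fun _ _ _ h => ⟨_, le_restr h, rfl⟩

theorem isTestFamily_branchTests (he : e = 0 ∨ e = 1) :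
    IsTestFamily (branchTests (C := C) (e := e)) where
  subset := fun _ _ h => h.1
  nonempty := fun _ _ ⟨_, _, hx, _⟩ =>
    have ⟨_, _, hB⟩ := hx 0
    ⟨_, hB⟩
  antitone := fun _ _ hpq _ hB => ⟨hB.1.trans (T_subset hpq), hB.2⟩
  restr := by
    rintro p B ⟨hBp, x, hxB, hBx⟩ ν ⟨μ, hμ, hνμ⟩ h
    obtain ⟨k, rfl⟩ := hBx μ hμ
    have hν := eq_initSeg_of_isPrefix hνμ
    refine ⟨{ρ ∈ B | ProperPrefix ν ρ}, ⟨fun ρ hρ => ⟨hBp hρ.1, hρ.2.1⟩, x, fun m => ?_,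
      fun ρ hρ => hBx ρ hρ.1⟩, fun ρ hρ => hρ.1, fun ρ hρ => hρ.2⟩
    obtain ⟨i, hi, hiB⟩ := hxB (max m ν.length)
    exact ⟨i, (le_max_left _ _).trans_lt hi, hiB,
      hν ▸ initSeg_properPrefix_of_lt x ((le_max_right _ _).trans_lt hi)⟩
  cone := fun he' => by obtain rfl | rfl := he <;> simp at he'

theorem IsBar.isThickAntichain (hA : IsBar thickTests p A) : p.IsThickAntichain A :=
  ⟨hA.subset, hA.antichain, fun q hpq => hA.meets q.T ⟨q, hpq, rfl⟩⟩

theorem IsBar.isFront (hA : IsBar branchTests p A) : IsFront p.T A := by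
  refine ⟨hA.subset, hA.antichain, fun x hx => ?_, fun η hη => (p.max_empty ▸ hη).elim⟩
  obtain ⟨ν, hν, _, ⟨-, k, rfl⟩, hνx⟩ := hA.meets {ν ∈ p.T | ∃ k, ν = initSeg x k}
    ⟨fun ν hν => hν.1, x, fun m => (hx m).imp fun k hk => ⟨hk.1, hk.2, k, rfl⟩, fun ν hν => hν.2⟩
  exact ⟨ν.length, eq_initSeg_of_isPrefix hνx ▸ hν⟩

theorem firstNodes_eq_minPts (p : QTree C e) (n : ℕ) :
    p.firstNodes n = minPts {ρ ∈ p.T | (n : ℝ) < (p.cr ρ).nor} := by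
  ext η
  refine ⟨fun ⟨h, hn, hmin⟩ => ⟨⟨h, cr_of_mem h ▸ hn⟩, fun ρ hρ hρη => ?_⟩,
    fun ⟨⟨h, hn⟩, hmin⟩ => ⟨h, cr_of_mem h ▸ hn, fun ρ hρη => ?_⟩⟩
  · exact (hmin ⟨ρ, hρ.1⟩ hρη).not_gt (cr_of_mem hρ.1 ▸ hρ.2)
  · exact not_lt.1 fun hρ => hmin ρ ⟨ρ.2, (cr_coe ρ).symm ▸ hρ⟩ hρη

theorem isBar_firstNodes {𝓑 : QTree C e → Set (Set (List α))} {n : ℕ}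
    (hn : ∀ B ∈ 𝓑 p, ∃ ν ∈ p.T, ν ∈ dcl B ∧ n < (p.cr ν).nor) : IsBar 𝓑 p (p.firstNodes n) := by
  rw [firstNodes_eq_minPts]
  refine ⟨fun η hη => hη.1.1, isPrefixAntichain_minPts _, fun B hB => ?_⟩
  obtain ⟨ν, hν, ⟨μ, hμ, hνμ⟩, hνn⟩ := hn B hB
  obtain ⟨η, hη, hην⟩ := subset_ucl_minPts {ρ ∈ p.T | (n : ℝ) < (p.cr ρ).nor} ⟨hν, hνn⟩
  exact ⟨η, hη, μ, hμ, hην.trans hνμ⟩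

theorem isBar_thickTests_firstNodes (hC : 2 ≤ e → C.IsBounded) (p : QTree C e) (n : ℕ) :
    IsBar thickTests p (p.firstNodes n) := by
  refine isBar_firstNodes ?_
  rintro _ ⟨q, hpq, rfl⟩
  exact exists_lt_nor_of_le hC hpq n

theorem isBar_branchTests_firstNodes (he : e = 0 ∨ e = 1) (p : QTree C e) (n : ℕ) :
    IsBar branchTests p (p.firstNodes n) := by
  refine isBar_firstNodes fun B ⟨hBp, x, hxB, _⟩ => ?_
  obtain ⟨k, hk, hkn⟩ := exists_initSeg_lt_nor he (lim_mono hBp hxB) n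
  obtain ⟨i, hki, hi⟩ := hxB k
  exact ⟨_, hk, ⟨_, hi, initSeg_prefix_of_le x hki.le⟩, hkn⟩

theorem lEn_succ {n : ℕ} (hpq : p ≤ q) (hn : IsPrefixAntichain (p.firstNodes n))
    (hkeep : ∀ ν ∈ p.T, (∀ η ∈ p.firstNodes n, ¬ ProperPrefix η ν) → ν ∈ q.T ∧ q.cr ν = p.cr ν)
    (hnor : e = 1 → ∀ ν ∈ q.T, q.cr ν = p.cr ν ∨ (n + 1 : ℕ) ≤ (q.cr ν).nor) :
    LEn (n + 1) p q := by
  obtain ⟨r, hr⟩ := p.quasi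
  have hrq : r ∈ q.T := (hkeep r hr.1 fun η hη hηr => hηr.not_isPrefix (hr.2 η hη.1)).1
  refine ⟨⟨hpq, r, hr, isRoot_of_le hr hpq hrq⟩, fun η hη ν hνη => ?_, ?_⟩
  · have ⟨hνq, hcr⟩ := hkeep ν ν.2 fun η' hη' hη'ν => hn η' hη' η hη (hη'ν.trans_isPrefix hνη)
    exact ⟨hνq, by rw [← cr_of_mem, hcr, cr_coe]⟩
  · rintro he c ⟨⟨η, rfl⟩, hc⟩
    rw [← cr_coe] at hc ⊢
    obtain heq | hlt := hnor he η η.2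
    · exact ⟨⟨η, T_subset hpq η.2⟩, by rw [heq, ← cr_coe]⟩
    · push_cast at hlt
      linarith

theorem exists_lEn_fusion {𝓑 : QTree C e → Set (Set (List α))} {𝒮 : ℕ → Set (QTree C e)}
    (h𝓑 : IsTestFamily 𝓑) (n : ℕ) (hp : ∀ m, IsBar 𝓑 p (p.firstNodes m))
    (hd : ∀ M k, IsDenseAlong 𝓑 M Set.univ (𝒮 k)) :
    ∃ q, LEn n p q ∧ ∀ k, ∀ B ∈ 𝓑 q, ∃ μ ∈ B, ∃ h, ∃ s ∈ 𝒮 k, s ≤ q.restr μ h := by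
  have exists_fusion_above {A : Set (List α)} (hA : IsBar 𝓑 p A) :=
    exists_fusion (n := n) h𝓑 (fun k => hd _ k) (fun k => Set.subset_univ _) hA
      fun ν hν => ⟨hA.subset hν, trivial⟩
  cases n with
  | zero =>
    obtain ⟨r, hr⟩ := p.quasi
    obtain ⟨q, hpq, hq, hkeep, -⟩ := exists_fusion_above (isBar_root h𝓑 hr)
    have hrq : r ∈ q.T := (hkeep r hr.1 fun η hη hηr => hηr.2 hη).1
    exact ⟨q, ⟨⟨hpq, r, hr, isRoot_of_le hr hpq hrq⟩, trivial⟩, hq⟩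
  | succ m =>
    obtain ⟨q, hpq, hq, hkeep, hnor⟩ := exists_fusion_above (hp m)
    exact ⟨q, lEn_succ hpq (hp m).antichain hkeep hnor, hq⟩

end Tests

section Deciding

variable {τ : PName (QTree C e)}

/-- The nodes of `p` above which `p` decides the value of `τ`. -/
def decidingNodes (p : QTree C e) (τ : PName (QTree C e)) : Set (List α) :=
  {ν | ∃ h : ν ∈ p.T, Decides (p.restr ν h) τ}

theorem exists_decidesAlong {𝓑 : QTree C e → Set (Set (List α))} {τ : ℕ → PName (QTree C e)}
    (h𝓑 : IsTestFamily 𝓑) (hp : ∀ k, ∀ B ∈ 𝓑 p, (B ∩ p.decidingNodes (τ k)).Nonempty) :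
    ∃ F : ℕ → Set (List α), (∀ k, IsBar 𝓑 p (F k)) ∧ p.DecidesAlong τ F := by
  obtain ⟨F, hF, hFτ, habove⟩ := exists_isBar_sequence h𝓑 (fun k ν hν => hν.1) hp
  exact ⟨F, hF, fun k => ⟨fun η _ hη => (hFτ k hη).2, habove k⟩⟩

theorem exists_thickAntichains {τ : ℕ → PName (QTree C e)}
    (hp : ∀ k, ∀ B ∈ p.thickTests, ∃ μ ∈ B, ∃ h, ∃ s ∈ {s | Decides s (τ k)}, s ≤ p.restr μ h) :
    ∃ A : ℕ → Set (List α), (∀ k, p.IsThickAntichain (A k)) ∧ p.DecidesAlong τ A := by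
  obtain ⟨A, hA, hτ⟩ := exists_decidesAlong isTestFamily_thickTests fun k B hB =>
    have ⟨μ, hμ, h, s, hs, hle⟩ := hp k B hB
    ⟨μ, hμ, h, hs.mono hle⟩
  exact ⟨A, fun k => (hA k).isThickAntichain, hτ⟩

theorem isDenseAlong_decides (hτ : IsOrdinalName τ) (M : ℝ) :
    IsDenseAlong thickTests M Set.univ {p | Decides p τ} := by
  rintro p - _ ⟨r, hpr, rfl⟩
  obtain ⟨q, hrq, hq⟩ := hτ r
  obtain ⟨ν, hν, hlarge⟩ := exists_isLarge_restr q M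
  exact ⟨ν, T_subset hrq hν, q.restr ν hν, hq.mono (le_restr hν), isRoot_restr hν,
    (hpr.trans hrq).trans (le_restr hν), hlarge p⟩

theorem exists_lEn_thickAntichains (hC : 2 ≤ e → C.IsBounded) (p : QTree C e) (n : ℕ)
    {τ : ℕ → PName (QTree C e)} (hτ : ∀ k, IsOrdinalName (τ k)) :
    ∃ (q : QTree C e) (A : ℕ → Set (List α)), (∀ k, q.IsThickAntichain (A k)) ∧
      LEn n p q ∧ q.DecidesAlong τ A := by
  obtain ⟨q, hpq, hq⟩ := exists_lEn_fusion isTestFamily_thickTests n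
    (isBar_thickTests_firstNodes hC p) fun M k => isDenseAlong_decides (hτ k) M
  obtain ⟨A, hA, hqA⟩ := exists_thickAntichains hq
  exact ⟨q, A, hA, hpq, hqA⟩

theorem exists_le_thickAntichains (p : QTree C e) {τ : ℕ → PName (QTree C e)}
    (hτ : ∀ k, IsOrdinalName (τ k)) :
    ∃ (q : QTree C e) (A : ℕ → Set (List α)), (∀ k, q.IsThickAntichain (A k)) ∧
      p ≤ q ∧ q.DecidesAlong τ A := by
  obtain ⟨r, hr⟩ := p.quasi
  obtain ⟨q, hpq, hq, -⟩ := exists_fusion (n := 0) isTestFamily_thickTests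
    (fun k => isDenseAlong_decides (hτ k) _) (fun k => Set.subset_univ _)
    (isBar_root isTestFamily_thickTests hr) (by rintro _ rfl; exact ⟨hr.1, trivial⟩)
  obtain ⟨A, hA, hqA⟩ := exists_thickAntichains hq
  exact ⟨q, A, hA, hpq, hqA⟩

end Deciding

section Fronts

variable {τ : PName (QTree C e)} {M : ℝ} {r μ : List α} {x : ℕ → α}

/-- Each branch of `p` passes through a node above which `p` decides the value of `τ`. -/
def DecidesOnBranches (p : QTree C e) (τ : PName (QTree C e)) : Prop :=
  ∀ x ∈ lim p.T, ∃ m, initSeg x m ∈ p.decidingNodes τ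

theorem decidesOnBranches_of_decides (h : Decides p τ) : DecidesOnBranches p τ := fun _ hx =>
  have ⟨m, _, hm⟩ := hx 0
  ⟨m, hm, h.mono (le_restr hm)⟩

theorem mem_decidingNodes_of_le {hμ : μ ∈ q.T} (hle : p ≤ q.restr μ hμ)
    (hη : η ∈ p.decidingNodes τ) (hρ : ρ ∈ q.T) (hηρ : η <+: ρ) (hμρ : μ <+: ρ) :
    ρ ∈ q.decidingNodes τ := by
  obtain ⟨hηp, hd⟩ := hη
  exact ⟨hρ, hd.mono (restr_le (hle.trans (restr_le_restr le_rfl hμ hρ hμρ)) hηp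
    fun ν hν => hηρ.trans hν.2)⟩

theorem DecidesOnBranches.exists_forall_mem_decidingNodes (hp : DecidesOnBranches p τ)
    (hx : x ∈ lim q.T) {k : ℕ} {hk : initSeg x k ∈ q.T} (hle : p ≤ q.restr _ hk) :
    ∃ m, ∀ i, m ≤ i → initSeg x i ∈ q.T → initSeg x i ∈ q.decidingNodes τ := by
  have hx_restr : x ∈ lim (q.restr _ hk).T := mem_lim_of_forall_mem_iff hx fun i hi =>
    ⟨fun h => ⟨h, initSeg_prefix_of_le x hi⟩, fun h => h.1⟩
  obtain ⟨m, hm⟩ := hp x (lim_mono (T_subset hle) hx_restr)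
  exact ⟨max m k, fun i hi hiq => mem_decidingNodes_of_le hle hm hiq
    (initSeg_prefix_of_le x ((le_max_left m k).trans hi))
    (initSeg_prefix_of_le x ((le_max_right m k).trans hi))⟩

theorem exists_initSeg_mem_pos_root (hr : IsRoot p.T r) (hx : x ∈ lim p.T) :
    ∃ k, initSeg x k ∈ (p.cr r).pos := by
  obtain ⟨k, hk, hkp⟩ := hx r.length
  obtain ⟨μ, hμ, hμx⟩ := exists_pos_cr_isPrefix hr.1 hkp
    (properPrefix_iff.2 ⟨hr.2 _ hkp, by simpa using hk⟩)
  exact ⟨μ.length, eq_initSeg_of_isPrefix hμx ▸ hμ⟩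

/-- The roots of the conditions stronger than `p` that decide `τ` on their branches and have large
norms. -/
def goodNodes (p : QTree C e) (τ : PName (QTree C e)) (M : ℝ) : Set (List α) :=
  {ν | ∃ q, p ≤ q ∧ IsRoot q.T ν ∧ DecidesOnBranches q τ ∧ IsLarge M p q}

/-- The initial segments of `ν` in `T` and their immediate successors. -/
def stem (T : Set (List α)) (ν : List α) : Set (List α) :=
  {ρ ∈ T | ∀ σ ∈ T, ProperPrefix σ ρ → σ <+: ν}

theorem isRoot_stem (hr : IsRoot T r) (ν : List α) : IsRoot (stem T ν) r :=
  ⟨⟨hr.1, fun σ hσ hσr => (hσr.not_isPrefix (hr.2 σ hσ)).elim⟩, fun ρ hρ => hr.2 ρ hρ.1⟩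

theorem succs_stem (hρν : ρ <+: ν) : succs (stem T ν) ρ = succs T ρ := by
  ext μ
  constructor
  · rintro ⟨⟨hμ, hμν⟩, hρμ, himm⟩
    exact ⟨hμ, hρμ, fun ⟨σ, hσ, hρσ, hσμ⟩ =>
      himm ⟨σ, ⟨hσ, fun π hπ hπσ => hμν π hπ (hπσ.trans_isPrefix hσμ.1)⟩, hρσ, hσμ⟩⟩
  · rintro ⟨hμ, hρμ, himm⟩
    refine ⟨⟨hμ, fun σ hσ hσμ => ?_⟩, hρμ, fun ⟨σ, hσ, hρσ, hσμ⟩ => himm ⟨σ, hσ.1, hρσ, hσμ⟩⟩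
    exact ((isPrefix_or_properPrefix hσμ.1 hρμ.1).resolve_right
      fun hρσ => himm ⟨σ, hσ, hρσ, hσμ⟩).trans hρν

theorem mem_hat_stem_iff : ρ ∈ hat (stem p.T ν) ↔ ρ ∈ p.T ∧ ρ <+: ν := by
  rw [mem_hat_iff]
  constructor
  · rintro ⟨hρ, π, hπ, hρπ⟩
    exact ⟨hρ.1, hπ.2 ρ hρ.1 hρπ⟩
  · rintro ⟨hρ, hρν⟩
    obtain ⟨μ, hμ⟩ := (p.cr ρ).pos_nonempty
    rw [pos_cr hρ, ← succs_stem hρν] at hμ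
    exact ⟨⟨hρ, fun σ _ hσρ => hσρ.1.trans hρν⟩, μ, hμ.1, hμ.2.1⟩

theorem isWellFoundedTree_stem (T : Set (List α)) (ν : List α) : IsWellFoundedTree (stem T ν) := by
  refine Set.eq_empty_of_forall_notMem fun x hx => ?_
  obtain ⟨m, hm, hmT⟩ := hx ν.length
  obtain ⟨k, hk, hkT⟩ := hx m
  have hle := (hkT.2 _ hmT.1 (initSeg_properPrefix_of_lt x hk)).length_le
  exact hm.not_ge (length_initSeg x m ▸ hle)

theorem isSystem_stem (p : QTree C e) (ν : List α) :
    IsSystem (stem p.T ν) fun ρ : hat (stem p.T ν) => p.cr ρ where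
  quasi := p.quasi.imp fun _ hr => isRoot_stem hr ν
  wf := isWellFoundedTree_stem p.T ν
  seqs := fun _ hρ => p.seqs hρ.1
  creature := fun ρ => cr_creature ρ.2.1.1
  pos_eq := fun ρ => by rw [pos_cr ρ.2.1.1, succs_stem (mem_hat_stem_iff.1 ρ.2).2]

theorem exists_mem_gens_of_isTOmittory (hC : C.IsTOmittory) (hr : IsRoot p.T r) (hν : ν ∈ p.T) :
    ∃ c ∈ p.gens, c.IsTreeCreatureAt r ∧ (p.cr ν).nor - 1 ≤ c.nor ∧ c.pos ⊆ (p.cr ν).pos := by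
  have hs := isSystem_stem p ν
  have hfin : (hat (stem p.T ν)).Finite := ν.inits.finite_toSet.subset fun ρ hρ => by
    simpa using (mem_hat_stem_iff.1 hρ).2
  have hνh : ν ∈ hat (stem p.T ν) := mem_hat_stem_iff.2 ⟨hν, List.prefix_rfl⟩
  have hmax : (p.cr ν).pos ⊆ maxPts (stem p.T ν) := by
    intro μ hμ
    refine of_not_not fun hμmax => ((cr_creature hν).properPrefix hμ).not_isPrefix ?_
    have hμs : μ ∈ stem p.T ν := (hs.pos_eq ⟨ν, hνh⟩ ▸ hμ : μ ∈ succs (stem p.T ν) ν).1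
    exact (mem_hat_stem_iff.1 ⟨hμs, hμmax⟩).2
  obtain ⟨c, hc, hnor, hpos⟩ :=
    hC _ _ hs hfin.countable (fun ρ => p.cr_mem_K ρ) ⟨ν, hνh⟩ hmax
  rw [← Set.image_eq_range] at hc
  obtain ⟨r', hr', hcr⟩ := (result_of_isSystem hs hc).1
  obtain rfl := (isRoot_stem hr ν).unique hr'
  exact ⟨c, ⟨_, fun ρ hρ => hρ.1.1, hc⟩, hcr, hnor, hpos⟩

theorem exists_le_mem_decidingNodes (hτ : IsOrdinalName τ) (hr : IsRoot p.T r) (M : ℝ) :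
    ∃ q, p ≤ q ∧ IsRoot q.T r ∧ ∃ ν ∈ q.decidingNodes τ, M ≤ (q.cr ν).nor := by
  obtain ⟨d, hpd, hd⟩ := hτ p
  obtain ⟨ν, hν, hνM⟩ := exists_le_nor d M
  have hroot : ∀ η ∈ ({ν} : Set (List α)), IsRoot (d.restr ν hν).T η := by
    rintro _ rfl
    exact isRoot_restr hν
  obtain ⟨q, hpq, hkeep, hglue⟩ := exists_glue
    (Set.singleton_subset_iff.2 (T_subset hpd hν)) (isPrefixAntichain_singleton ν) hroot
    fun _ _ => hpd.trans (le_restr hν)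
  obtain ⟨hνq, heq⟩ := hglue ν rfl
  have hrq : r ∈ q.T := by
    by_cases hrν : r ∈ ucl {ν}
    · obtain ⟨_, rfl, hνr⟩ := hrν
      exact hνr.eq_of_length_le (hr.2 _ (T_subset hpq hνq)).length_le ▸ hνq
    · exact (hkeep r hr.1 hrν).1
  have hcr : q.cr ν = d.cr ν := by
    rw [← cr_restr (isRoot_restr hνq).1, heq, cr_restr (isRoot_restr hν).1]
  exact ⟨q, hpq, isRoot_of_le hr hpq hrq, ν, ⟨hνq, heq ▸ hd.mono (le_restr hν)⟩, hcr ▸ hνM⟩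

theorem root_mem_goodNodes_of_isTOmittory {p : QTree C 0} {τ : PName (QTree C 0)}
    (hC : C.IsTOmittory) (hτ : IsOrdinalName τ) (hr : IsRoot p.T r) : r ∈ p.goodNodes τ M := by
  obtain ⟨p', hpp', hr', ν, ⟨hν, hd⟩, hνM⟩ := exists_le_mem_decidingNodes hτ hr (M + 1)
  obtain ⟨c, hc, hcr, hnor, hpos⟩ := exists_mem_gens_of_isTOmittory hC hr' hν
  obtain ⟨q, hp'q, hrq, rfl, hrestr⟩ := exists_replaceRoot hc hcr
  refine ⟨q, hpp'.trans hp'q, hrq, fun x hx => ?_, fun _ ρ hρ => ?_, by simp, by simp⟩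
  · obtain ⟨k, hk⟩ := exists_initSeg_mem_pos_root hrq hx
    obtain ⟨h, h', heq⟩ := hrestr _ hk
    have hνk := ((cr_creature hν).properPrefix (hpos hk)).1
    exact ⟨k, h, heq ▸ hd.mono (restr_le_restr le_rfl hν h' hνk)⟩
  · obtain rfl := hρ.unique hrq
    linarith

theorem mem_goodNodes_of_pos_subset {p : QTree C 1} {τ : PName (QTree C 1)}
    {s : WeakCreature H D} (hs : s ∈ p.gens) (hsν : s.IsTreeCreatureAt ν)
    (hpos : s.pos ⊆ p.goodNodes τ M) (hsM : s = p.cr ν ∨ M ≤ s.nor) : ν ∈ p.goodNodes τ M := by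
  have : Nonempty (QTree C 1) := ⟨p⟩
  choose! f hle hroot hd hlarge using hpos
  obtain ⟨q, hpq, hrq, rfl, hrestr⟩ := exists_amalgamation hs hsν hroot hle
  refine ⟨q, hpq, hrq, fun x hx => ?_, by simp, fun _ ρ hρ => ?_, by simp⟩
  · obtain ⟨k, hk⟩ := exists_initSeg_mem_pos_root hrq hx
    obtain ⟨h, heq⟩ := hrestr _ hk
    obtain ⟨m, hm⟩ := (hd hk).exists_forall_mem_decidingNodes hx heq.ge
    obtain ⟨i, hi, hiq⟩ := hx m
    exact ⟨i, hm i hi.le hiq⟩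
  · by_cases hρν : ν = ρ
    · exact hρν ▸ hsM
    · obtain ⟨μ, hμ, hμρ⟩ := exists_pos_cr_isPrefix hrq.1 hρ ⟨hrq.2 ρ hρ, hρν⟩
      obtain ⟨h, heq⟩ := hrestr μ hμ
      have hρμ : ρ ∈ (q.restr μ h).T := ⟨hρ, hμρ⟩
      rw [← cr_restr hρμ, heq]
      exact (hlarge hμ).new rfl ρ (heq ▸ hρμ)

theorem exists_mem_goodNodes_of_le (hτ : IsOrdinalName τ) (hpq : p ≤ q) (M : ℝ) :
    ∃ ν ∈ q.T, ν ∈ p.goodNodes τ M := by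
  obtain ⟨d, hqd, hd⟩ := hτ q
  obtain ⟨ν, hν, hlarge⟩ := exists_isLarge_restr d M
  exact ⟨ν, T_subset hqd hν, d.restr ν hν, (hpq.trans hqd).trans (le_restr hν), isRoot_restr hν,
    decidesOnBranches_of_decides (hd.mono (le_restr hν)), hlarge p⟩

open Classical in
theorem exists_pos_subset_or_subset_compl (hC : C.IsBig 2) (hc : c ∈ C.K) (hc1 : 1 < c.nor)
    (G : Set (List α)) :
    ∃ s ∈ C.Sig {c}, (s.pos ⊆ G ∨ s.pos ⊆ Gᶜ) ∧ c.nor - 1 ≤ s.nor := by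
  obtain ⟨s, hs, ⟨i, hi⟩, hnor⟩ := hC c hc hc1 fun ν => if ν ∈ G then 0 else 1
  refine ⟨s, hs, ?_, hnor⟩
  by_cases h : i = 0
  · exact .inl fun ν hν => by simpa [h] using hi ν hν
  · exact .inr fun ν hν hνG => h (by simpa [hνG] using (hi ν hν).symm)

theorem mem_goodNodes_of_isBig {p : QTree C 1} {τ : PName (QTree C 1)} (hC : C.IsBig 2)
    (hτ : IsOrdinalName τ) (hν : ν ∈ p.T) : ν ∈ p.goodNodes τ M := by
  by_contra hbad
  obtain ⟨ν₀, hν₀, hν₀M⟩ := exists_forall_le_nor (S := p.T \ p.goodNodes τ M)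
    Set.sdiff_subset ⟨ν, hν, hbad⟩ (max M 1 + 2)
  let S : Set (List α) := {ρ ∈ p.T \ p.goodNodes τ M | ProperPrefix ν₀ ρ}
  have hS : S.Nonempty := by
    obtain ⟨μ, hμ, hμbad⟩ := Set.not_subset.1 fun hpos => hν₀.2
      (mem_goodNodes_of_pos_subset (cr_mem_gens hν₀.1) (cr_creature hν₀.1) hpos (.inl rfl))
    exact ⟨μ, ⟨pos_cr_subset hν₀.1 hμ, hμbad⟩, (cr_creature hν₀.1).properPrefix hμ⟩
  have hbig : ∀ ρ ∈ S, ∃ s ∈ p.gens, s.IsTreeCreatureAt ρ ∧ s.pos ⊆ S ∧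
      (p.cr ρ).nor - 1 ≤ s.nor := by
    rintro ρ ⟨⟨hρ, hρbad⟩, hν₀ρ⟩
    have hρM := hν₀M ρ ⟨hρ, hρbad⟩ hν₀ρ
    have hM := le_max_left M 1
    have h1 := le_max_right M 1
    obtain ⟨s, hs, hpos, hnor⟩ := exists_pos_subset_or_subset_compl hC (p.cr_mem_K ρ)
      (by linarith) (p.goodNodes τ M)
    have hsg := sig_singleton_subset_gens hρ hs
    have hsρ := isTreeCreatureAt_of_mem_sig hρ hs
    have hpos := hpos.resolve_left fun hpos => hρbad
      (mem_goodNodes_of_pos_subset hsg hsρ hpos (.inr (by linarith)))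
    exact ⟨s, hsg, hsρ, fun μ hμ => ⟨⟨pos_subset_of_mem_gens hsg hμ, hpos hμ⟩,
      hν₀ρ.trans_isPrefix (hsρ.properPrefix hμ).1⟩, hnor⟩
  have : Nonempty (WeakCreature H D) := ⟨p.cr ν⟩
  choose! σ hgens hσ hpos hnor using hbig
  obtain ⟨μ, hμ⟩ := hS
  obtain ⟨q, hpq, hqS⟩ := exists_prune (fun ρ hρ => hρ.1.1) hμ hgens hσ hpos hnor
  obtain ⟨ρ, hρ, hρgood⟩ := exists_mem_goodNodes_of_le hτ hpq M
  exact (hqS hρ).1.2 hρgood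

theorem isDenseAlong_decidesOnBranches (he : e = 0 ∧ C.IsTOmittory ∨ e = 1 ∧ C.IsBig 2)
    (hτ : IsOrdinalName τ) (M : ℝ) :
    IsDenseAlong branchTests M Set.univ {p | DecidesOnBranches p τ} := by
  intro p _ B hB
  have h𝓑 := isTestFamily_branchTests (C := C) (he.imp And.left And.left)
  obtain ⟨μ, hμ⟩ := h𝓑.nonempty p B hB
  have hμp := h𝓑.subset p B hB hμ
  have hμgood : μ ∈ (p.restr μ hμp).goodNodes τ M := by
    obtain ⟨rfl, hC⟩ | ⟨rfl, hC⟩ := he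
    exacts [root_mem_goodNodes_of_isTOmittory hC hτ (isRoot_restr hμp),
      mem_goodNodes_of_isBig hC hτ (isRoot_restr hμp).1]
  obtain ⟨q, hle, hrq, hd, hlarge⟩ := hμgood
  exact ⟨μ, hμ, q, hd, hrq, (le_restr hμp).trans hle, hlarge.of_restr hle⟩

theorem exists_lEn_fronts (he : e = 0 ∧ C.IsTOmittory ∨ e = 1 ∧ C.IsBig 2) (p : QTree C e) (n : ℕ)
    {τ : ℕ → PName (QTree C e)} (hτ : ∀ k, IsOrdinalName (τ k)) :
    ∃ (q : QTree C e) (F : ℕ → Set (List α)), (∀ k, IsFront q.T (F k)) ∧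
      LEn n p q ∧ q.DecidesAlong τ F := by
  have he01 : e = 0 ∨ e = 1 := he.imp And.left And.left
  have h𝓑 := isTestFamily_branchTests (C := C) he01
  obtain ⟨q, hpq, hq⟩ := exists_lEn_fusion h𝓑 n (isBar_branchTests_firstNodes he01 p)
    fun M k => isDenseAlong_decidesOnBranches he (hτ k) M
  have hmeets : ∀ k, ∀ B ∈ q.branchTests, (B ∩ q.decidingNodes (τ k)).Nonempty := by
    intro k B hB
    obtain ⟨μ, hμ, hμq, s, hs, hle⟩ := hq k B hB
    obtain ⟨hBq, x, hxB, hBx⟩ := hB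
    obtain ⟨i, rfl⟩ := hBx μ hμ
    obtain ⟨m, hm⟩ := DecidesOnBranches.exists_forall_mem_decidingNodes hs (lim_mono hBq hxB) hle
    obtain ⟨j, hmj, hjB⟩ := hxB m
    exact ⟨_, hjB, hm j hmj.le (hBq hjB)⟩
  obtain ⟨F, hF, hqF⟩ := exists_decidesAlong h𝓑 hmeets
  exact ⟨q, F, fun k => (hF k).isFront, hpq, hqF⟩

end Fronts

section Proper

variable {𝒩 : Set (QTree C e)} {𝔇 : Set (Set (QTree C e))}

/-- The trace `𝒩` on the conditions and `𝔇` on the dense sets of a model is rich enough to run a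
fusion inside: the witnesses that the fusion asks for can be chosen in `𝒩`. -/
structure IsReflecting (𝒩 : Set (QTree C e)) (𝔇 : Set (Set (QTree C e))) : Prop where
  exists_mem_le : ∀ 𝒟 ∈ 𝔇, ∀ q ∈ 𝒩, (∃ d ∈ 𝒟, d ≤ q) → ∃ d ∈ 𝒟, d ∈ 𝒩 ∧ d ≤ q
  exists_isLarge : ∀ 𝒟 ∈ 𝔇, ∀ p ∈ 𝒩, ∀ (k : ℕ) (μ : List α),
    (∃ q, (∃ d ∈ 𝒟, d ≤ q) ∧ IsRoot q.T μ ∧ p ≤ q ∧ IsLarge k p q) →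
      ∃ q ∈ 𝒩, (∃ d ∈ 𝒟, d ≤ q) ∧ IsRoot q.T μ ∧ p ≤ q ∧ IsLarge k p q

theorem IsReflecting.isDenseAlong (h : IsReflecting 𝒩 𝔇) {𝒟 : Set (QTree C e)} (h𝒟 : 𝒟 ∈ 𝔇)
    (hdense : IsDense 𝒟) (k : ℕ) :
    IsDenseAlong thickTests k 𝒩 {q ∈ 𝒩 | ∃ d ∈ 𝒟, d ∈ 𝒩 ∧ d ≤ q} := by
  rintro p hp _ ⟨r, hpr, rfl⟩
  obtain ⟨d, hd, hrd⟩ := hdense r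
  obtain ⟨μ, hμ, hlarge⟩ := exists_isLarge_restr d (k : ℝ)
  obtain ⟨q, hq, hdq, hμq, hpq, hlarge⟩ := h.exists_isLarge 𝒟 h𝒟 p hp k μ
    ⟨d.restr μ hμ, ⟨d, hd, le_restr hμ⟩, isRoot_restr hμ, (hpr.trans hrd).trans (le_restr hμ),
      hlarge p⟩
  exact ⟨μ, T_subset hrd hμ, q, ⟨hq, h.exists_mem_le 𝒟 h𝒟 q hq hdq⟩, hμq, hpq, hlarge⟩

theorem IsReflecting.exists_generic (h : IsReflecting 𝒩 𝔇) (h𝔇 : 𝔇.Countable)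
    (hdense : ∀ 𝒟 ∈ 𝔇, IsDense 𝒟) (hp : p ∈ 𝒩) :
    ∃ q, p ≤ q ∧ ∀ 𝒟 ∈ 𝔇, ∀ r, q ≤ r → ∃ d ∈ 𝒟, d ∈ 𝒩 ∧ Compatible d r := by
  obtain rfl | hne := 𝔇.eq_empty_or_nonempty
  · exact ⟨p, le_rfl, fun _ h𝒟 => h𝒟.elim⟩
  obtain ⟨𝒟, rfl⟩ := h𝔇.exists_eq_range hne
  obtain ⟨r, hr⟩ := p.quasi
  obtain ⟨q, hpq, hq, -⟩ := exists_fusion (n := 0) isTestFamily_thickTests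
    (fun k => h.isDenseAlong ⟨k, rfl⟩ (hdense _ ⟨k, rfl⟩) (k + 0)) (fun k => Set.sep_subset _ _)
    (isBar_root isTestFamily_thickTests hr)
    (by rintro _ rfl; exact ⟨hr.1, (restr_root hr).symm ▸ hp⟩)
  refine ⟨q, hpq, Set.forall_mem_range.2 fun k r hqr => ?_⟩
  obtain ⟨μ, hμ, hμq, s, ⟨-, d, hd, hd𝒩, hds⟩, hs⟩ := hq k r.T ⟨r, hqr, rfl⟩
  exact ⟨d, hd, hd𝒩, r.restr μ hμ,
    (hds.trans hs).trans (restr_le_restr hqr hμq hμ List.prefix_rfl), le_restr hμ⟩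

theorem isProper (hH : (⋃ i, H i).Countable) : IsProper (QTree C e) := by
  intro X i hi
  have : Countable (Seqs H) := countable_seqs hH
  obtain ⟨𝒞, h𝒞, hreflect⟩ := exists_isClubCountable_reflecting hi
    fun (j : Option (ℕ × Seqs H)) (p : QTree C e) 𝒟 q => match j with
      | none => q ∈ 𝒟 ∧ q ≤ p
      | some (k, μ) => (∃ d ∈ 𝒟, d ≤ q) ∧ IsRoot q.T μ ∧ p ≤ q ∧ IsLarge k p q
  refine ⟨𝒞, h𝒞, fun N hN p hp => ?_⟩
  let 𝒩 : Set (QTree C e) := {q | i (.inl q) ∈ N}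
  let 𝔇 : Set (Set (QTree C e)) := {𝒟 | IsDense 𝒟 ∧ i (.inr 𝒟) ∈ N}
  have h𝔇 : 𝔇.Countable :=
    ((h𝒞.countable N hN).preimage (hi.comp Sum.inr_injective)).mono fun _ h𝒟 => h𝒟.2
  have h𝒩 : IsReflecting 𝒩 𝔇 := by
    constructor
    · rintro 𝒟 h𝒟 q hq ⟨d, hd⟩
      obtain ⟨d', ⟨hd', hle⟩, hd'N⟩ := hreflect N hN none q 𝒟 d hq h𝒟.2 hd
      exact ⟨d', hd', hd'N, hle⟩
    · rintro 𝒟 h𝒟 p hp k μ ⟨q, hq⟩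
      obtain ⟨q', hq', hq'N⟩ :=
        hreflect N hN (some (k, ⟨μ, q.seqs hq.2.1.1⟩)) p 𝒟 q hp h𝒟.2 hq
      exact ⟨q', hq'N, hq'⟩
  obtain ⟨q, hpq, hq⟩ := h𝒩.exists_generic h𝔇 (fun _ h𝒟 => h𝒟.1) hp
  exact ⟨q, hpq, fun 𝒟 h𝒟 h𝒟N => hq 𝒟 ⟨h𝒟, h𝒟N⟩⟩

end Proper

end QTree

end TreeCreature

theorem mainTheorem11_general {α D : Type u} (H : ℕ → Set α) (C : TreeCreatingPair H D) :
    (∀ e : Fin 4, (⋃ i, H i).Countable → IsProper (QTree C e)) ∧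
    (∀ e : Fin 4, (2 ≤ e → C.IsBounded) →
      ∀ (p : QTree C e) (n : ℕ) (τ : ℕ → PName (QTree C e)), (∀ k, IsOrdinalName (τ k)) →
        ∃ (q : QTree C e) (A : ℕ → Set (List α)), (∀ k, q.IsThickAntichain (A k)) ∧
          QTree.LEn n p q ∧ q.DecidesAlong τ A) ∧
    (∀ (e : Fin 4) (p : QTree C e) (τ : ℕ → PName (QTree C e)), (∀ k, IsOrdinalName (τ k)) →
        ∃ (q : QTree C e) (A : ℕ → Set (List α)), (∀ k, q.IsThickAntichain (A k)) ∧
          p ≤ q ∧ q.DecidesAlong τ A) ∧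
    (∀ e : Fin 4, (e = 0 ∧ C.IsTOmittory ∨ e = 1 ∧ C.IsBig 2) →
      ∀ (p : QTree C e) (n : ℕ) (τ : ℕ → PName (QTree C e)), (∀ k, IsOrdinalName (τ k)) →
        ∃ (q : QTree C e) (F : ℕ → Set (List α)), (∀ k, IsFront q.T (F k)) ∧
          QTree.LEn n p q ∧ q.DecidesAlong τ F) :=
  ⟨fun _ => QTree.isProper, fun _ hC p n _ => QTree.exists_lEn_thickAntichains hC p n,
    fun _ p _ => QTree.exists_le_thickAntichains p,
    fun _ he p n _ => QTree.exists_lEn_fronts he p n⟩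

theorem mainTheorem11 {α D : Type u} (H : ℕ → Set α) (C : TreeCreatingPair H D) :
    -- properness
    (∀ e : Fin 4, (e = 2 → C.IsBounded) → (⋃ i, H i).Countable → IsProper (QTree C e)) ∧
    -- names for ordinals are decided on thick antichains, for `e < 3`
    (∀ e : Fin 4, e < 3 → (e = 2 → C.IsBounded) →
      ∀ (p : QTree C e) (n : ℕ) (τ : ℕ → PName (QTree C e)), (∀ k, IsOrdinalName (τ k)) →
        ∃ (q : QTree C e) (A : ℕ → Set (List α)), (∀ k, q.IsThickAntichain (A k)) ∧
          QTree.LEn n p q ∧ q.DecidesAlong τ A) ∧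
    -- and for `e = 3`
    (∀ (p : QTree C 3) (τ : ℕ → PName (QTree C 3)), (∀ k, IsOrdinalName (τ k)) →
        ∃ (q : QTree C 3) (A : ℕ → Set (List α)), (∀ k, q.IsThickAntichain (A k)) ∧
          p ≤ q ∧ q.DecidesAlong τ A) ∧
    -- names for ordinals are decided on fronts
    (∀ e : Fin 4, (e = 0 ∧ C.IsTOmittory ∨ e = 1 ∧ C.IsBig 2) →
      ∀ (p : QTree C e) (n : ℕ) (τ : ℕ → PName (QTree C e)), (∀ k, IsOrdinalName (τ k)) →
        ∃ (q : QTree C e) (F : ℕ → Set (List α)), (∀ k, IsFront q.T (F k)) ∧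
          QTree.LEn n p q ∧ q.DecidesAlong τ F) := by
  obtain ⟨hproper, hthick, hle, hfront⟩ := mainTheorem11_general H C
  exact ⟨fun e _ => hproper e, fun e he hC => hthick e fun he' => hC (by omega), hle 3, hfront⟩
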